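/- Let $t\ge 3$ be odd. A $t$-Schur overpartition of $n\ge 0$ is an overpartition of $n$ (a partition of $n$ in which the first occurrence of each distinct part may be overlined) all of whose parts are congruent modulo $2t$ to an element of $\{1,3,5,\dots,2t-1\}\setminus\{t\}$. Let $\overline{S_t}(n)$ denote the number of $t$-Schur overpartitions of $n$ and, for $r\ge 1$, let $\overline{S_t}^{\,r}(n)$ denote the number of $r$-tuples of $t$-Schur overpartitions whose sizes add up to $n$; equivalently, \[ \sum_{n\ge 0}\overline{S_t}^{\,r}(n)q^n=\prod_{k\ge 1}\left(\frac{(1+q^{2k-1})(1-q^{t(2k-1)})}{(1+q^{t(2k-1)})(1-q^{2k-1})}\right)^{r},\qquad \overline{S_t}=\overline{S_t}^{\,1}. \] Let $p\ge 5$ be a prime, let $\left(\frac{\cdot}{p}\right)$ be the Legendre symbol, and let $\alpha,m,n\ge 0$ and $1\le i\le p-1$ be integers. Then: 1. If $p\equiv 5\pmod 6$, then $\overline{S_9}\big(6p^{2\alpha+2}n+(6i+3p)p^{2\alpha+1}\big)\equiv 0\pmod 3$. 2. If $\left(\frac{-18}{p}\right)=-1$, then $\overline{S_9}^{\,16m+1}\big(24p^{2\alpha+2}n+(24i+11p)p^{2\alpha+1}\big)\equiv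 0\pmod{32}$. 3. If $\left(\frac{-3}{p}\right)=-1$, then $\overline{S_9}^{\,8m+1}\big(18p^{2\alpha+2}n+3(6i+p)p^{2\alpha+1}\big)\equiv 0\pmod{16}$. 4. If $\left(\frac{-9}{p}\right)=-1$, then $\overline{S_9}^{\,8m+1}\big(12p^{2\alpha+2}n+(12i+5p)p^{2\alpha+1}\big)\equiv 0\pmod{16}$. 5. If $\left(\frac{-3}{p}\right)=-1$, then $\overline{S_9}^{\,4m+1}\big(6p^{2\alpha+2}n+(6i+p)p^{2\alpha+1}\big)\equiv 0\pmod 8$. -/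

import Mathlib

/-- The set of residues `I(t) = {1, 3, 5, …, 2t - 1} \ {t}` modulo `2t`. -/
def schurResidues (t : ℕ) : Finset ℕ :=
  (Finset.range (2 * t)).filter fun i => Odd i ∧ i ≠ t

/-- The `t`-Schur partitions of `n`: every part is congruent modulo `2t` to an element of
`I(t)`. -/
def schurPartitions (t n : ℕ) : Finset n.Partition :=
  Finset.univ.filter fun μ => ∀ a ∈ μ.parts, a % (2 * t) ∈ schurResidues t

/-- The `t`-Schur overpartitions of `n`: a `t`-Schur partition of `n` together with the set of
those part sizes whose first occurrence is overlined. -/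
def schurOverpartitions (t n : ℕ) : Finset ((_ : n.Partition) × Finset ℕ) :=
  (schurPartitions t n).sigma fun μ => μ.parts.toFinset.powerset

/-- The ordered `r`-tuples of `t`-Schur overpartitions of total size `n`: a tuple of sizes
`k₁, …, k_r` with sum `n`, and for each `j` a `t`-Schur overpartition of `k_j`. -/
def schurOverpartitionTuples (t r n : ℕ) :
    Finset ((k : Fin r → ℕ) × ((j : Fin r) → (_ : (k j).Partition) × Finset ℕ)) :=
  (Finset.Nat.antidiagonalTuple r n).sigma fun k =>
    Fintype.piFinset fun j => schurOverpartitions t (k j)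

/-- The number of `t`-Schur overpartitions of `n`. -/
def numSchurOverpartitions (t n : ℕ) : ℕ :=
  (schurOverpartitions t n).card

/-- The number of `r`-tuples of `t`-Schur overpartitions of total size `n`. -/
def numSchurOverpartitionTuples (t r n : ℕ) : ℕ :=
  (schurOverpartitionTuples t r n).card

/-! By the Jacobi triple product, the generating function `F` of `9`-Schur overpartitions is a
quotient of values of Ramanujan's theta function `f(a, b)`. Splitting `f(q, q) = ∑ q ^ (n ^ 2)` and
`f(-q ^ 2, -q ^ 2) = ∑ (-1) ^ n * q ^ (2 * n ^ 2)` according to `n` modulo `3` gives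
`F * (1 - 2 * q ^ 2 * V(q ^ 6)) = 1 + 2 * q * U(q ^ 3)` with `U`, `V` quotients of theta functions.
Multiplying by `1 + x + x ^ 2` for `x = 2 * q ^ 2 * V(q ^ 6)` turns the factor on the left into a
series in `q ^ 6`, so that the residues of the exponents modulo `6` separate.

Modulo a power of `2`, or modulo `3`, each residue class that matters is a constant times a product
of two theta functions. On completing squares, a nonzero coefficient attached to `N` makes a
multiple of `N` by a number prime to `p` equal to `x ^ 2 + D * y ^ 2` with `-D` a non-residue modulo
`p`; then `p` divides `N` to an even power, whereas the arguments of the theorem have odd `p`-adic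
valuation. Tuples come for free: `F ≡ 1` modulo `2`, hence `F ^ (2 ^ k * m) ≡ 1` modulo
`2 ^ (k + 1)`. -/

open PowerSeries
open scoped PowerSeries.WithPiTopology

section Summation

theorem hasSum_add_of_bijective_sumElim {ι α β M : Type*} [AddCommMonoid M] [TopologicalSpace M]
    [ContinuousAdd M] {f : ι → M} {g : α → ι} {h : β → ι} {s t : M}
    (hgh : (Sum.elim g h).Bijective) (hs : HasSum (f ∘ g) s) (ht : HasSum (f ∘ h) t) :
    HasSum f (s + t) :=
  (Equiv.ofBijective _ hgh).hasSum_iff.1 (HasSum.sum hs ht)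

theorem bijective_two_mul_sumElim :
    (Sum.elim (fun n : ℤ => 2 * n) fun n : ℤ => 2 * n + 1).Bijective := by
  constructor
  · rintro (m | m) (n | n) h <;> simp only [Sum.elim_inl, Sum.elim_inr] at h <;> grind
  · intro n
    rcases Int.emod_two_eq_zero_or_one n with h | h
    exacts [⟨.inl (n / 2), by grind⟩, ⟨.inr (n / 2), by grind⟩]

theorem bijective_three_mul_sumElim :
    (Sum.elim (fun n : ℤ => 3 * n)
      (Sum.elim (fun n : ℤ => 3 * n + 1) fun n : ℤ => 3 * n - 1)).Bijective := by
  constructor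
  · rintro (m | m | m) (n | n | n) h <;> simp only [Sum.elim_inl, Sum.elim_inr] at h <;> grind
  · intro n
    obtain h | h | h : n % 3 = 0 ∨ n % 3 = 1 ∨ n % 3 = 2 := by omega
    exacts [⟨.inl (n / 3), by grind⟩, ⟨.inr (.inl (n / 3)), by grind⟩,
      ⟨.inr (.inr (n / 3 + 1)), by grind⟩]

theorem bijective_parity_sumElim :
    (Sum.elim (fun i : ℤ × ℤ => (i.1 + i.2, i.2 - i.1))
      fun i : ℤ × ℤ => (1 - i.1 - i.2, i.1 - i.2)).Bijective := by
  constructor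
  · rintro (⟨i, j⟩ | ⟨i, j⟩) (⟨k, l⟩ | ⟨k, l⟩) h <;>
      simp only [Sum.elim_inl, Sum.elim_inr, Prod.mk.injEq] at h <;> grind
  · rintro ⟨m, n⟩
    rcases Int.emod_two_eq_zero_or_one (m + n) with h | h
    · exact ⟨.inl ((m - n) / 2, (m + n) / 2), by grind⟩
    · exact ⟨.inr ((1 - m + n) / 2, (1 - m - n) / 2), by grind⟩

theorem summable_of_X_pow_dvd {ι R : Type*} [Semiring R] [TopologicalSpace R]
    {f : ι → R⟦X⟧} {e : ι → ℕ} (hf : ∀ i, X ^ e i ∣ f i) (he : ∀ d, {i | e i ≤ d}.Finite) :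
    Summable f := by
  rw [WithPiTopology.summable_iff_summable_coeff]
  refine fun d => summable_of_hasFiniteSupport ((he d).subset fun i hi => ?_)
  by_contra h
  exact hi (X_pow_dvd_iff.1 (hf i) d (not_le.1 h))

theorem finite_natAbs_sq_le (d : ℕ) : {n : ℤ | n.natAbs ^ 2 ≤ d}.Finite := by
  refine (Set.finite_Icc (-d : ℤ) d).subset fun n hn => ?_
  have : n.natAbs ≤ d := (Nat.le_self_pow two_ne_zero _).trans hn
  simp only [Set.mem_Icc]
  omega

end Summation

section Triangle

/-- The triangular number `n (n + 1) / 2` attached to an integer `n`. -/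
def triangle (n : ℤ) : ℕ :=
  (n * (n + 1) / 2).toNat

theorem two_mul_triangle (n : ℤ) : (2 * triangle n : ℤ) = n * (n + 1) := by
  have h : 0 ≤ n * (n + 1) := by
    rcases le_or_gt 0 n with h | h
    · positivity
    · exact mul_nonneg_of_nonpos_of_nonpos h.le (by omega)
  rw [triangle, Int.toNat_of_nonneg (Int.ediv_nonneg h two_pos.le),
    Int.mul_ediv_cancel' (Int.even_mul_succ_self n).two_dvd]

theorem triangle_add_triangle_neg (n : ℤ) : triangle n + triangle (-n) = n.natAbs ^ 2 := by
  zify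
  rw [sq_abs]
  linarith [two_mul_triangle n, two_mul_triangle (-n)]

theorem triangle_zero : triangle 0 = 0 := rfl

end Triangle

section Theta

variable {R : Type*} [CommRing R]

/-- The general term `a ^ (n (n + 1) / 2) * b ^ (n (n - 1) / 2)` of Ramanujan's theta function
`f(a, b)`. -/
def thetaTerm {M : Type*} [Monoid M] (a b : M) (n : ℤ) : M :=
  a ^ triangle n * b ^ triangle (-n)

theorem thetaTerm_two_mul (a c : R) (n : ℤ) :
    thetaTerm a (a * c) (2 * n) = thetaTerm (a ^ 4 * c) (a ^ 4 * c ^ 3) n := by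
  have ha : triangle (2 * n) + triangle (-(2 * n)) = 4 * (triangle n + triangle (-n)) := by
    grind [two_mul_triangle]
  have hc : triangle (-(2 * n)) = triangle n + 3 * triangle (-n) := by
    grind [two_mul_triangle]
  rw [thetaTerm, mul_pow, ← mul_assoc, ← pow_add, ha, hc, thetaTerm]
  ring

theorem thetaTerm_two_mul_add_one (a c : R) (n : ℤ) :
    thetaTerm a (a * c) (2 * n + 1) = a * thetaTerm (a ^ 8 * c ^ 3) c n := by
  have ha : triangle (2 * n + 1) + triangle (-(2 * n + 1)) = 8 * triangle n + 1 := by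
    grind [two_mul_triangle]
  have hc : triangle (-(2 * n + 1)) = 3 * triangle n + triangle (-n) := by
    grind [two_mul_triangle]
  rw [thetaTerm, mul_pow, ← mul_assoc, ← pow_add, ha, hc, thetaTerm]
  ring

theorem thetaTerm_three_mul (a b : R) (n : ℤ) :
    thetaTerm a b (3 * n) = thetaTerm (a ^ 6 * b ^ 3) (a ^ 3 * b ^ 6) n := by
  have ha : triangle (3 * n) = 6 * triangle n + 3 * triangle (-n) := by
    grind [two_mul_triangle]
  have hb : triangle (-(3 * n)) = 3 * triangle n + 6 * triangle (-n) := by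
    grind [two_mul_triangle]
  rw [thetaTerm, ha, hb, thetaTerm]
  ring

theorem thetaTerm_three_mul_add_one (a b : R) (n : ℤ) :
    thetaTerm a b (3 * n + 1) = a * thetaTerm (a ^ 9 * b ^ 6) (b ^ 3) n := by
  have ha : triangle (3 * n + 1) = 9 * triangle n + 1 := by
    grind [two_mul_triangle]
  have hb : triangle (-(3 * n + 1)) = 6 * triangle n + 3 * triangle (-n) := by
    grind [two_mul_triangle]
  rw [thetaTerm, ha, hb, thetaTerm]
  ring

theorem thetaTerm_three_mul_sub_one (a b : R) (n : ℤ) :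
    thetaTerm a b (3 * n - 1) = b * thetaTerm (a ^ 3) (a ^ 6 * b ^ 9) n := by
  have ha : triangle (3 * n - 1) = 3 * triangle n + 6 * triangle (-n) := by
    grind [two_mul_triangle]
  have hb : triangle (-(3 * n - 1)) = 9 * triangle (-n) + 1 := by
    grind [two_mul_triangle]
  rw [thetaTerm, ha, hb, thetaTerm]
  ring

theorem thetaTerm_mul_thetaTerm (a x y : R) (m n : ℤ) :
    thetaTerm a (a * x * y) m * thetaTerm (a * x) (a * y) n =
      a ^ (triangle m + triangle (-m) + triangle n + triangle (-n)) *
        x ^ (triangle (-m) + triangle n) * y ^ (triangle (-m) + triangle (-n)) := by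
  simp only [thetaTerm]
  ring

theorem thetaTerm_mul_thetaTerm_even (a x y : R) (i j : ℤ) :
    thetaTerm a (a * x * y) (i + j) * thetaTerm (a * x) (a * y) (j - i) =
      thetaTerm (a ^ 2 * y) (a ^ 2 * x ^ 2 * y) i *
        thetaTerm (a ^ 2 * x) (a ^ 2 * x * y ^ 2) j := by
  have ha : triangle (i + j) + triangle (-(i + j)) + triangle (j - i) + triangle (-(j - i)) =
      2 * (triangle i + triangle (-i)) + 2 * (triangle j + triangle (-j)) := by
    grind [two_mul_triangle]
  have hx : triangle (-(i + j)) + triangle (j - i) =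
      2 * triangle (-i) + triangle j + triangle (-j) := by
    grind [two_mul_triangle]
  have hy : triangle (-(i + j)) + triangle (-(j - i)) =
      triangle i + triangle (-i) + 2 * triangle (-j) := by
    grind [two_mul_triangle]
  rw [thetaTerm_mul_thetaTerm, ha, hx, hy, thetaTerm, thetaTerm]
  ring

theorem thetaTerm_mul_thetaTerm_odd (a x y : R) (i j : ℤ) :
    thetaTerm a (a * x * y) (1 - i - j) * thetaTerm (a * x) (a * y) (i - j) =
      a * (thetaTerm x (a ^ 4 * x * y ^ 2) i * thetaTerm y (a ^ 4 * x ^ 2 * y) j) := by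
  have ha : triangle (1 - i - j) + triangle (-(1 - i - j)) + triangle (i - j) +
      triangle (-(i - j)) = 4 * triangle (-i) + 4 * triangle (-j) + 1 := by
    grind [two_mul_triangle]
  have hx : triangle (-(1 - i - j)) + triangle (i - j) =
      triangle i + triangle (-i) + 2 * triangle (-j) := by
    grind [two_mul_triangle]
  have hy : triangle (-(1 - i - j)) + triangle (-(i - j)) =
      2 * triangle (-i) + triangle j + triangle (-j) := by
    grind [two_mul_triangle]
  rw [thetaTerm_mul_thetaTerm, ha, hx, hy, thetaTerm, thetaTerm]
  ring

theorem map_thetaTerm {S F : Type*} [CommRing S] [FunLike F R S] [MonoidHomClass F R S] (φ : F)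
    (a b : R) (n : ℤ) : φ (thetaTerm a b n) = thetaTerm (φ a) (φ b) n := by
  simp only [thetaTerm, map_mul, map_pow]

theorem X_pow_dvd_thetaTerm {a b : R⟦X⟧} (ha : constantCoeff a = 0) (hb : constantCoeff b = 0)
    (n : ℤ) : X ^ n.natAbs ^ 2 ∣ thetaTerm a b n := by
  rw [← triangle_add_triangle_neg, pow_add]
  exact mul_dvd_mul (pow_dvd_pow_of_dvd (X_dvd_iff.2 ha) _) (pow_dvd_pow_of_dvd (X_dvd_iff.2 hb) _)

variable [TopologicalSpace R]

/-- Ramanujan's theta function `f(a, b) = ∑ n : ℤ, a ^ (n (n + 1) / 2) * b ^ (n (n - 1) / 2)`, for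
power series `a` and `b` without constant term. -/
noncomputable def theta (a b : R⟦X⟧) : R⟦X⟧ :=
  ∑' n : ℤ, thetaTerm a b n

theorem summable_thetaTerm {a b : R⟦X⟧} (ha : constantCoeff a = 0) (hb : constantCoeff b = 0) :
    Summable (thetaTerm a b) :=
  summable_of_X_pow_dvd (X_pow_dvd_thetaTerm ha hb) finite_natAbs_sq_le

theorem summable_thetaTerm_mul_thetaTerm {a b c d : R⟦X⟧} (ha : constantCoeff a = 0)
    (hb : constantCoeff b = 0) (hc : constantCoeff c = 0) (hd : constantCoeff d = 0) :
    Summable fun i : ℤ × ℤ => thetaTerm a b i.1 * thetaTerm c d i.2 := by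
  refine summable_of_X_pow_dvd (e := fun i => i.1.natAbs ^ 2 + i.2.natAbs ^ 2) (fun i => ?_)
    fun k => ?_
  · rw [pow_add]
    exact mul_dvd_mul (X_pow_dvd_thetaTerm ha hb _) (X_pow_dvd_thetaTerm hc hd _)
  · exact ((finite_natAbs_sq_le k).prod (finite_natAbs_sq_le k)).subset fun i hi =>
      ⟨(Nat.le_add_right _ _).trans hi, (Nat.le_add_left _ _).trans hi⟩

theorem hasSum_theta {a b : R⟦X⟧} (ha : constantCoeff a = 0) (hb : constantCoeff b = 0) :
    HasSum (thetaTerm a b) (theta a b) :=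
  (summable_thetaTerm ha hb).hasSum

theorem theta_comm (a b : R⟦X⟧) : theta a b = theta b a := by
  rw [theta, theta, ← (Equiv.neg ℤ).tsum_eq]
  simp only [thetaTerm, Equiv.neg_apply, neg_neg, mul_comm]

theorem continuous_expand (k : ℕ) (hk : k ≠ 0) : Continuous (expand k hk : R⟦X⟧ → R⟦X⟧) := by
  rw [continuous_iff_continuousAt]
  intro A
  rw [ContinuousAt, WithPiTopology.tendsto_iff_coeff_tendsto]
  intro d
  simp only [coeff_expand]
  split_ifs
  · exact (WithPiTopology.continuous_coeff R _).tendsto A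
  · exact tendsto_const_nhds

theorem expand_theta [T2Space R] {a b : R⟦X⟧} (ha : constantCoeff a = 0)
    (hb : constantCoeff b = 0) (k : ℕ) (hk : k ≠ 0) :
    expand k hk (theta a b) = theta (expand k hk a) (expand k hk b) := by
  refine ((hasSum_theta ha hb).map (expand k hk) (continuous_expand k hk)).unique ?_
  simpa only [Function.comp_def, map_thetaTerm] using
    hasSum_theta (a := expand k hk a) (b := expand k hk b) (by simpa) (by simpa)

variable [IsTopologicalRing R] [T2Space R] {a b c x y : R⟦X⟧}

theorem theta_eq_theta_add_mul_theta (ha : constantCoeff a = 0) (hc : constantCoeff c = 0) :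
    theta a (a * c) = theta (a ^ 4 * c) (a ^ 4 * c ^ 3) + a * theta c (a ^ 8 * c ^ 3) := by
  rw [theta_comm c]
  refine (hasSum_add_of_bijective_sumElim bijective_two_mul_sumElim ?_ ?_).tsum_eq
  · simpa only [Function.comp_def, thetaTerm_two_mul] using
      hasSum_theta (a := a ^ 4 * c) (b := a ^ 4 * c ^ 3) (by simp [ha]) (by simp [ha])
  · simpa only [Function.comp_def, thetaTerm_two_mul_add_one] using
      (hasSum_theta (a := a ^ 8 * c ^ 3) (by simp [ha]) hc).mul_left a

theorem theta_eq_theta_add_mul_theta_add_mul_theta (ha : constantCoeff a = 0)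
    (hb : constantCoeff b = 0) :
    theta a b = theta (a ^ 6 * b ^ 3) (a ^ 3 * b ^ 6) +
      (a * theta (a ^ 9 * b ^ 6) (b ^ 3) + b * theta (a ^ 3) (a ^ 6 * b ^ 9)) := by
  refine (hasSum_add_of_bijective_sumElim bijective_three_mul_sumElim ?_
    (HasSum.sum ?_ ?_)).tsum_eq
  · simpa only [Function.comp_def, thetaTerm_three_mul] using
      hasSum_theta (a := a ^ 6 * b ^ 3) (b := a ^ 3 * b ^ 6) (by simp [ha]) (by simp [ha])
  · simpa only [Function.comp_def, Sum.elim_inl, thetaTerm_three_mul_add_one] using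
      (hasSum_theta (a := a ^ 9 * b ^ 6) (b := b ^ 3) (by simp [ha]) (by simp [hb])).mul_left a
  · simpa only [Function.comp_def, Sum.elim_inr, thetaTerm_three_mul_sub_one] using
      (hasSum_theta (a := a ^ 3) (b := a ^ 6 * b ^ 9) (by simp [ha]) (by simp [ha])).mul_left b

theorem hasSum_theta_mul_theta {d : R⟦X⟧} (ha : constantCoeff a = 0) (hb : constantCoeff b = 0)
    (hc : constantCoeff c = 0) (hd : constantCoeff d = 0) :
    HasSum (fun i : ℤ × ℤ => thetaTerm a b i.1 * thetaTerm c d i.2) (theta a b * theta c d) :=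
  (hasSum_theta ha hb).mul (hasSum_theta hc hd) (summable_thetaTerm_mul_thetaTerm ha hb hc hd)

theorem theta_mul_theta_parity (ha : constantCoeff a = 0) (hx : constantCoeff x = 0)
    (hy : constantCoeff y = 0) :
    theta a (a * x * y) * theta (a * x) (a * y) =
      theta (a ^ 2 * y) (a ^ 2 * x ^ 2 * y) * theta (a ^ 2 * x) (a ^ 2 * x * y ^ 2) +
        a * (theta x (a ^ 4 * x * y ^ 2) * theta y (a ^ 4 * x ^ 2 * y)) := by
  refine (hasSum_theta_mul_theta ha (by simp [ha]) (by simp [ha]) (by simp [ha])).unique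
    (hasSum_add_of_bijective_sumElim bijective_parity_sumElim ?_ ?_)
  · simpa only [Function.comp_def, thetaTerm_mul_thetaTerm_even] using
      hasSum_theta_mul_theta (a := a ^ 2 * y) (b := a ^ 2 * x ^ 2 * y) (c := a ^ 2 * x)
        (d := a ^ 2 * x * y ^ 2) (by simp [ha]) (by simp [ha]) (by simp [ha]) (by simp [ha])
  · simpa only [Function.comp_def, thetaTerm_mul_thetaTerm_odd] using
      (hasSum_theta_mul_theta (a := x) (b := a ^ 4 * x * y ^ 2) (c := y)
        (d := a ^ 4 * x ^ 2 * y) hx (by simp [ha]) hy (by simp [ha])).mul_left a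

end Theta

section GaussBinom

variable {R : Type*} [CommRing R]

/-- The Gaussian binomial coefficient with parameter `q`, defined by its Pascal recursion. -/
def gaussBinom (q : R) : ℕ → ℕ → R
  | _, 0 => 1
  | 0, _ + 1 => 0
  | n + 1, k + 1 => gaussBinom q n k + q ^ (k + 1) * gaussBinom q n (k + 1)

theorem gaussBinom_zero_right (q : R) (n : ℕ) : gaussBinom q n 0 = 1 := by
  cases n <;> rfl

theorem gaussBinom_succ_succ (q : R) (n k : ℕ) :
    gaussBinom q (n + 1) (k + 1) = gaussBinom q n k + q ^ (k + 1) * gaussBinom q n (k + 1) :=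
  rfl

theorem gaussBinom_eq_zero (q : R) {n k : ℕ} (h : n < k) : gaussBinom q n k = 0 := by
  induction n generalizing k with
  | zero => obtain ⟨k, rfl⟩ := Nat.exists_eq_succ_of_ne_zero h.ne'; rfl
  | succ n ih =>
    obtain ⟨k, rfl⟩ := Nat.exists_eq_succ_of_ne_zero (by omega : k ≠ 0)
    rw [gaussBinom_succ_succ, ih (by omega), ih (by omega), mul_zero, add_zero]

theorem gaussBinom_succ_succ' (q : R) {n k : ℕ} (h : k ≤ n) :
    gaussBinom q (n + 1) (k + 1) = q ^ (n - k) * gaussBinom q n k + gaussBinom q n (k + 1) := by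
  obtain ⟨m, rfl⟩ := Nat.exists_eq_add_of_le h
  rw [Nat.add_sub_cancel_left]
  induction m generalizing k with
  | zero => simp [gaussBinom_succ_succ, gaussBinom_eq_zero]
  | succ m ihm =>
    induction k with
    | zero =>
      have := ihm (Nat.zero_le (0 + m))
      simp only [zero_add, gaussBinom_succ_succ, gaussBinom_zero_right] at this ⊢
      linear_combination q * this
    | succ k ihk =>
      have h₁ := ihk (Nat.le_add_right _ _)
      have h₂ := ihm (Nat.le_add_right (k + 1) m)
      rw [show k + 1 + m = k + (m + 1) by ring] at h₂
      rw [show k + 1 + (m + 1) = k + (m + 1) + 1 by ring, gaussBinom_succ_succ q _ (k + 1)]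
      linear_combination h₁ + q ^ (k + 2) * h₂ -
        q ^ (m + 1) * gaussBinom_succ_succ q (k + (m + 1)) k -
        gaussBinom_succ_succ q (k + (m + 1)) (k + 1)

/-- The finite `q`-Pochhammer symbol `(a; q)ₙ`. -/
def qPochhammer (a q : R) (n : ℕ) : R :=
  ∏ k ∈ Finset.range n, (1 - a * q ^ k)

theorem qPochhammer_succ (a q : R) (n : ℕ) :
    qPochhammer a q (n + 1) = qPochhammer a q n * (1 - a * q ^ n) :=
  Finset.prod_range_succ _ _

theorem qPochhammer_mul_qPochhammer_mul_gaussBinom (q : R) (i j : ℕ) :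
    qPochhammer q q i * qPochhammer q q j * gaussBinom q (i + j) i = qPochhammer q q (i + j) := by
  induction i generalizing j with
  | zero => simp [qPochhammer, gaussBinom_zero_right]
  | succ i ihi =>
    induction j with
    | zero =>
      have := ihi 0
      rw [add_zero] at this ⊢
      rw [gaussBinom_succ_succ, gaussBinom_eq_zero q (Nat.lt_succ_self i), qPochhammer_succ q q i]
      linear_combination (1 - q * q ^ i) * this
    | succ j ihj =>
      have hi := ihi (j + 1)
      rw [show i + (j + 1) = i + 1 + j by ring] at hi
      rw [← add_assoc, gaussBinom_succ_succ, qPochhammer_succ q q (i + 1 + j)]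
      rw [qPochhammer_succ q q i] at ihj ⊢
      rw [qPochhammer_succ q q j] at hi ⊢
      linear_combination (1 - q * q ^ i) * hi + q ^ (i + 1) * (1 - q * q ^ j) * ihj

theorem pow_succ_dvd_qPochhammer_sub (q : R) {m n : ℕ} (h : m ≤ n) :
    q ^ (m + 1) ∣ qPochhammer q q n - qPochhammer q q m := by
  induction n, h using Nat.le_induction with
  | base => simp
  | succ n h ih =>
    rw [qPochhammer_succ, mul_sub, mul_one, sub_right_comm, ← pow_succ']
    exact dvd_sub ih ((pow_dvd_pow q (by omega)).mul_left _)

theorem pow_succ_dvd_gaussBinom_mul_qPochhammer_sub_one {q : R} {m i j n : ℕ}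
    (hq : IsUnit (qPochhammer q q m)) (hi : m ≤ i) (hj : m ≤ j) (hn : m ≤ n) :
    q ^ (m + 1) ∣ gaussBinom q (i + j) i * qPochhammer q q n - 1 := by
  obtain ⟨a, ha⟩ := pow_succ_dvd_qPochhammer_sub q hi
  obtain ⟨b, hb⟩ := pow_succ_dvd_qPochhammer_sub q hj
  obtain ⟨c, hc⟩ := pow_succ_dvd_qPochhammer_sub q hn
  obtain ⟨d, hd⟩ := pow_succ_dvd_qPochhammer_sub q (show m ≤ i + j by omega)
  have h := qPochhammer_mul_qPochhammer_mul_gaussBinom q i j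
  rw [← hq.dvd_mul_left]
  use d - gaussBinom q (i + j) i *
    (a * qPochhammer q q j + qPochhammer q q m * b - qPochhammer q q m * c)
  linear_combination h + hd - gaussBinom q (i + j) i *
    (qPochhammer q q j * ha + qPochhammer q q m * hb - qPochhammer q q m * hc)

end GaussBinom

section TripleProduct

variable {R : Type*} [CommRing R]

theorem thetaTerm_mul_pow_left (x y : R) {i : ℤ} {m n : ℕ} (h : i + n = m) :
    thetaTerm x y i * (x * (x * y) ^ m) = (x * y) ^ n * thetaTerm x y (i + 1) := by
  have hx : triangle i + 1 + m = n + triangle (i + 1) := by grind [two_mul_triangle]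
  have hy : triangle (-i) + m = n + triangle (-(i + 1)) := by grind [two_mul_triangle]
  calc
    _ = x ^ (triangle i + 1 + m) * y ^ (triangle (-i) + m) := by rw [thetaTerm]; ring
    _ = _ := by rw [hx, hy, thetaTerm]; ring

theorem thetaTerm_mul_pow_right (x y : R) {i : ℤ} {m n : ℕ} (h : i + n = m) :
    thetaTerm x y i * (y * (x * y) ^ n) = (x * y) ^ m * thetaTerm x y (i - 1) := by
  have hx : triangle i + n = m + triangle (i - 1) := by grind [two_mul_triangle]
  have hy : triangle (-i) + 1 + n = m + triangle (-(i - 1)) := by grind [two_mul_triangle]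
  calc
    _ = x ^ (triangle i + n) * y ^ (triangle (-i) + 1 + n) := by rw [thetaTerm]; ring
    _ = _ := by rw [hx, hy, thetaTerm]; ring

theorem sum_range_succ_add_sum_range_succ {M : Type*} [AddCommMonoid M] (u v : ℕ → M) {n : ℕ}
    (hv : v (n + 1) = 0) :
    ∑ j ∈ Finset.range (n + 1), u j + ∑ j ∈ Finset.range (n + 1), v j =
      ∑ j ∈ Finset.range (n + 1), (u j + v (j + 1)) + v 0 := by
  rw [Finset.sum_add_distrib, add_assoc, ← Finset.sum_range_succ' v,
    Finset.sum_range_succ v (n + 1), hv, add_zero]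

theorem sum_gaussBinom_mul_thetaTerm_succ_left (x y : R) {m n k : ℕ} (hk : k = m + n) :
    (∑ j ∈ Finset.range (k + 1), gaussBinom (x * y) k j * thetaTerm x y (j - n)) *
        (1 + x * (x * y) ^ m) =
      ∑ j ∈ Finset.range (k + 2), gaussBinom (x * y) (k + 1) j * thetaTerm x y (j - n) := by
  have hshift : ∀ j ∈ Finset.range (k + 1),
      gaussBinom (x * y) k j * thetaTerm x y (j - n) * (x * (x * y) ^ m) =
        (x * y) ^ (k - j) * gaussBinom (x * y) k j * thetaTerm x y (j + 1 - n) := by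
    intro j hj
    have hj := Finset.mem_range_succ_iff.1 hj
    rw [mul_assoc, thetaTerm_mul_pow_left x y (n := k - j) (by omega), sub_add_eq_add_sub]
    ring
  rw [mul_add, mul_one, add_comm, Finset.sum_mul, Finset.sum_congr rfl hshift,
    sum_range_succ_add_sum_range_succ _ _ (by simp [gaussBinom_eq_zero]),
    Finset.sum_range_succ' _ (k + 1)]
  congr 1
  · refine Finset.sum_congr rfl fun j hj => ?_
    rw [gaussBinom_succ_succ' _ (Finset.mem_range_succ_iff.1 hj)]
    push_cast
    ring
  · simp only [gaussBinom_zero_right]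

theorem sum_gaussBinom_mul_thetaTerm_succ_right (x y : R) (n k : ℕ) :
    (∑ j ∈ Finset.range (k + 1), gaussBinom (x * y) k j * thetaTerm x y (j - n)) *
        (1 + y * (x * y) ^ n) =
      ∑ j ∈ Finset.range (k + 2), gaussBinom (x * y) (k + 1) j *
        thetaTerm x y (j - (n + 1 : ℕ)) := by
  have hshift : ∀ j ∈ Finset.range (k + 1),
      gaussBinom (x * y) k j * thetaTerm x y (j - n) * (y * (x * y) ^ n) =
        (x * y) ^ j * gaussBinom (x * y) k j * thetaTerm x y (j - (n + 1 : ℕ)) := by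
    intro j _
    rw [mul_assoc, thetaTerm_mul_pow_right x y (sub_add_cancel _ _), sub_sub]
    push_cast
    ring
  rw [mul_add, mul_one, Finset.sum_mul, Finset.sum_congr rfl hshift,
    sum_range_succ_add_sum_range_succ _ _ (by simp [gaussBinom_eq_zero]),
    Finset.sum_range_succ' _ (k + 1)]
  congr 1
  · refine Finset.sum_congr rfl fun j _ => ?_
    rw [gaussBinom_succ_succ]
    push_cast
    ring_nf
  · simp only [gaussBinom_zero_right, pow_zero, one_mul]

theorem qPochhammer_mul_qPochhammer_eq_sum (x y : R) (m n : ℕ) :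
    qPochhammer (-x) (x * y) m * qPochhammer (-y) (x * y) n =
      ∑ j ∈ Finset.range (m + n + 1), gaussBinom (x * y) (m + n) j * thetaTerm x y (j - n) := by
  induction m with
  | zero =>
    induction n with
    | zero => simp [qPochhammer, gaussBinom_zero_right, thetaTerm, triangle_zero]
    | succ n ih =>
      rw [qPochhammer_succ, ← mul_assoc, ih, neg_mul, sub_neg_eq_add,
        sum_gaussBinom_mul_thetaTerm_succ_right, ← add_assoc]
  | succ m ih =>
    rw [qPochhammer_succ, mul_right_comm, ih, neg_mul, sub_neg_eq_add,
      sum_gaussBinom_mul_thetaTerm_succ_left x y rfl, add_right_comm m 1 n]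

end TripleProduct

section QPochhammerInf

open Filter Topology

variable {R : Type*} [CommRing R] {a q : R⟦X⟧}

theorem isUnit_of_constantCoeff_eq_one {A : R⟦X⟧} (h : constantCoeff A = 1) : IsUnit A := by
  rw [isUnit_iff_constantCoeff, h]
  exact isUnit_one

theorem isUnit_qPochhammer_self (hq : constantCoeff q = 0) (n : ℕ) :
    IsUnit (qPochhammer q q n) :=
  isUnit_of_constantCoeff_eq_one <| by
    rw [qPochhammer, map_prod]
    exact Finset.prod_eq_one fun k _ => by simp [hq]

theorem X_pow_dvd_qPochhammer_mul_sub_sum_thetaTerm {b : R⟦X⟧} (ha : constantCoeff a = 0)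
    (hb : constantCoeff b = 0) (n : ℕ) :
    X ^ n ∣ qPochhammer (-a) (a * b) n * qPochhammer (-b) (a * b) n *
      qPochhammer (a * b) (a * b) n - ∑ j ∈ Finset.range (n + n + 1), thetaTerm a b (j - n) := by
  have hab : constantCoeff (a * b) = 0 := by simp [ha]
  rw [qPochhammer_mul_qPochhammer_eq_sum, Finset.sum_mul, ← Finset.sum_sub_distrib]
  refine Finset.dvd_sum fun j hj => ?_
  obtain ⟨k, hk⟩ := Nat.exists_eq_add_of_le (Finset.mem_range_succ_iff.1 hj)
  have hdvd := pow_succ_dvd_gaussBinom_mul_qPochhammer_sub_one (i := j) (j := k) (n := n)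
    (m := min j k) (isUnit_qPochhammer_self hab _) (min_le_left _ _) (min_le_right _ _) (by omega)
  rw [show gaussBinom (a * b) (n + n) j * thetaTerm a b (j - n) * qPochhammer (a * b) (a * b) n -
    thetaTerm a b (j - n) = (gaussBinom (a * b) (j + k) j * qPochhammer (a * b) (a * b) n - 1) *
      thetaTerm a b (j - n) by rw [hk]; ring]
  refine (pow_dvd_pow X (?_ : n ≤ min j k + 1 + ((j : ℤ) - n).natAbs ^ 2)).trans ?_
  · have := Nat.le_self_pow two_ne_zero ((j : ℤ) - n).natAbs
    omega
  · rw [pow_add]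
    exact mul_dvd_mul ((pow_dvd_pow_of_dvd (X_dvd_iff.2 hab) _).trans hdvd)
      (X_pow_dvd_thetaTerm ha hb _)

variable [TopologicalSpace R]

/-- The infinite `q`-Pochhammer symbol `(a; q)_∞` of power series. -/
noncomputable def qPochhammerInf (a q : R⟦X⟧) : R⟦X⟧ :=
  ∏' k : ℕ, (1 - a * q ^ k)

theorem hasProd_qPochhammerInf (a : R⟦X⟧) (hq : constantCoeff q = 0) :
    HasProd (fun k : ℕ => 1 - a * q ^ k) (qPochhammerInf a q) := by
  simp only [qPochhammerInf, sub_eq_add_neg]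
  refine (WithPiTopology.multipliable_one_add_of_tendsto_order_atTop_nhds_top _ ?_).hasProd
  refine ENat.tendsto_nhds_top_iff_natCast_lt.2 fun n =>
    eventually_atTop.2 ⟨n + 1, fun k hk => ?_⟩
  rw [order_neg, ← Order.add_one_le_iff_of_not_isMax (by simp), ← Nat.cast_add_one]
  refine le_order _ _ fun i hi => X_pow_dvd_iff.1 (Dvd.dvd.mul_left ?_ a) i (Nat.cast_lt.1 hi)
  exact (pow_dvd_pow X hk).trans (pow_dvd_pow_of_dvd (X_dvd_iff.2 hq) k)

theorem tendsto_zero_of_X_pow_dvd {f : ℕ → R⟦X⟧} (hf : ∀ n, X ^ n ∣ f n) :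
    Tendsto f atTop (𝓝 0) := by
  refine (WithPiTopology.tendsto_iff_coeff_tendsto R f _ _).2 fun d => ?_
  exact tendsto_const_nhds.congr' (eventually_atTop.2 ⟨d + 1, fun n hn =>
    (map_zero _).trans (X_pow_dvd_iff.1 (hf n) d hn).symm⟩)

theorem sum_range_two_mul_add_one_eq_sum_Icc {M : Type*} [AddCommMonoid M] (f : ℤ → M) (n : ℕ) :
    ∑ j ∈ Finset.range (n + n + 1), f (j - n) = ∑ i ∈ Finset.Icc (-n : ℤ) n, f i := by
  refine Finset.sum_nbij' (fun j => (j : ℤ) - n) (fun i => (i + n).toNat) ?_ ?_ ?_ ?_ ?_ <;>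
    intro i hi <;> simp only [Finset.mem_range, Finset.mem_Icc] at hi ⊢ <;> omega

theorem tendsto_sum_range_thetaTerm {b : R⟦X⟧} (ha : constantCoeff a = 0)
    (hb : constantCoeff b = 0) :
    Tendsto (fun n : ℕ => ∑ j ∈ Finset.range (n + n + 1), thetaTerm a b (j - n)) atTop
      (𝓝 (theta a b)) := by
  simp only [sum_range_two_mul_add_one_eq_sum_Icc]
  exact SummationFilter.hasSum_symmetricIcc_iff.1
    ((hasSum_theta ha hb).mono_left (SummationFilter.LeAtTop.le_atTop))

variable [T2Space R]

theorem isUnit_qPochhammerInf (ha : constantCoeff a = 0) (hq : constantCoeff q = 0) :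
    IsUnit (qPochhammerInf a q) := by
  refine isUnit_of_constantCoeff_eq_one (((hasProd_qPochhammerInf a hq).map _
    (WithPiTopology.continuous_constantCoeff R)).unique ?_)
  convert hasProd_one using 2 with k
  simp [ha]

variable [IsTopologicalRing R]

theorem theta_eq_qPochhammerInf {b : R⟦X⟧} (ha : constantCoeff a = 0) (hb : constantCoeff b = 0) :
    theta a b = qPochhammerInf (-a) (a * b) * qPochhammerInf (-b) (a * b) *
      qPochhammerInf (a * b) (a * b) := by
  have hab : constantCoeff (a * b) = 0 := by simp [ha]
  have hprod (c : R⟦X⟧) := (hasProd_qPochhammerInf c hab).tendsto_prod_nat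
  have hsum := (tendsto_zero_of_X_pow_dvd (X_pow_dvd_qPochhammer_mul_sub_sum_thetaTerm ha hb)).add
    (tendsto_sum_range_thetaTerm ha hb)
  simp only [sub_add_cancel, zero_add] at hsum
  exact tendsto_nhds_unique hsum (((hprod _).mul (hprod _)).mul (hprod _))

theorem qPochhammerInf_eq_prod_range (a : R⟦X⟧) (hq : constantCoeff q = 0) {k : ℕ} (hk : k ≠ 0) :
    qPochhammerInf a q = ∏ j ∈ Finset.range k, qPochhammerInf (a * q ^ j) (q ^ k) := by
  have : NeZero k := ⟨hk⟩
  have hfiber (j : Fin k) : HasProd (fun n : ℕ => 1 - a * q ^ (j + k * n))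
      (qPochhammerInf (a * q ^ (j : ℕ)) (q ^ k)) := by
    simpa only [pow_add, pow_mul, mul_assoc] using
      hasProd_qPochhammerInf (a * q ^ (j : ℕ)) (q := q ^ k) (by simp [hq, hk])
  have hprod := ((Equiv.prodComm (Fin k) ℕ).trans (Nat.divModEquiv k).symm).hasProd_iff.2
    (hasProd_qPochhammerInf a hq)
  rw [Finset.prod_range]
  refine (hprod.prod_fiberwise fun j => ?_).unique (hasProd_fintype _)
  convert hfiber j using 4 with n
  simp [Nat.divModEquiv_symm_apply, add_comm, mul_comm]

theorem qPochhammerInf_mul_qPochhammerInf_neg (a : R⟦X⟧) (hq : constantCoeff q = 0) :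
    qPochhammerInf a q * qPochhammerInf (-a) q = qPochhammerInf (a ^ 2) (q ^ 2) := by
  refine ((hasProd_qPochhammerInf a hq).mul (hasProd_qPochhammerInf (-a) hq)).unique ?_
  convert hasProd_qPochhammerInf (a ^ 2) (q := q ^ 2) (by simp [hq]) using 2 with n
  ring

theorem isUnit_theta {b : R⟦X⟧} (ha : constantCoeff a = 0) (hb : constantCoeff b = 0) :
    IsUnit (theta a b) := by
  have hab : constantCoeff (a * b) = 0 := by simp [ha]
  rw [theta_eq_qPochhammerInf ha hb]
  exact ((isUnit_qPochhammerInf (by simp [ha]) hab).mul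
    (isUnit_qPochhammerInf (by simp [hb]) hab)).mul (isUnit_qPochhammerInf hab hab)

end QPochhammerInf

section ProductIdentities

variable {R : Type*} [CommRing R] [TopologicalSpace R] [IsTopologicalRing R] [T2Space R]
  {a q : R⟦X⟧}

theorem qPochhammerInf_eq_mul (a : R⟦X⟧) (hq : constantCoeff q = 0) :
    qPochhammerInf a q = qPochhammerInf a (q ^ 2) * qPochhammerInf (a * q) (q ^ 2) := by
  simpa [Finset.prod_range_succ] using qPochhammerInf_eq_prod_range a hq two_ne_zero

theorem qPochhammerInf_eq_mul_mul (a : R⟦X⟧) (hq : constantCoeff q = 0) :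
    qPochhammerInf a q = qPochhammerInf a (q ^ 3) * qPochhammerInf (a * q) (q ^ 3) *
      qPochhammerInf (a * q ^ 2) (q ^ 3) := by
  simpa [Finset.prod_range_succ] using qPochhammerInf_eq_prod_range a hq three_ne_zero

theorem qPochhammerInf_self_eq_mul (ha : constantCoeff a = 0) :
    qPochhammerInf a a = qPochhammerInf a (a ^ 2) * qPochhammerInf (a ^ 2) (a ^ 2) := by
  rw [qPochhammerInf_eq_mul a ha, ← sq]

theorem qPochhammerInf_sq_mul_qPochhammerInf_neg (ha : constantCoeff a = 0) :
    qPochhammerInf a (a ^ 2) * qPochhammerInf (-a) a = 1 := by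
  refine (isUnit_qPochhammerInf (a := a ^ 2) (q := a ^ 2) (by simp [ha])
    (by simp [ha])).mul_left_cancel ?_
  have h := qPochhammerInf_mul_qPochhammerInf_neg a ha
  rw [qPochhammerInf_self_eq_mul ha] at h
  linear_combination h

theorem theta_neg_neg_eq_qPochhammerInf {b : R⟦X⟧} (ha : constantCoeff a = 0)
    (hb : constantCoeff b = 0) :
    theta (-a) (-b) = qPochhammerInf a (a * b) * qPochhammerInf b (a * b) *
      qPochhammerInf (a * b) (a * b) := by
  simpa using theta_eq_qPochhammerInf (a := -a) (b := -b) (by simpa) (by simpa)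

theorem theta_self_eq_qPochhammerInf (ha : constantCoeff a = 0) :
    theta a a = qPochhammerInf (-a) (a ^ 2) ^ 2 * qPochhammerInf (a ^ 2) (a ^ 2) := by
  rw [theta_eq_qPochhammerInf ha ha]
  ring_nf

theorem theta_neg_self_eq_qPochhammerInf (ha : constantCoeff a = 0) :
    theta (-a) (-a) = qPochhammerInf a (a ^ 2) ^ 2 * qPochhammerInf (a ^ 2) (a ^ 2) := by
  rw [theta_neg_neg_eq_qPochhammerInf ha ha]
  ring_nf

theorem theta_pow_three_eq_qPochhammerInf (ha : constantCoeff a = 0) :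
    theta a (a ^ 3) = qPochhammerInf (-a) (a ^ 2) * qPochhammerInf (a ^ 4) (a ^ 4) := by
  rw [theta_eq_qPochhammerInf ha (by simp [ha]),
    qPochhammerInf_eq_mul (-a) (q := a ^ 2) (by simp [ha])]
  ring_nf

theorem theta_neg_neg_sq_eq_qPochhammerInf (ha : constantCoeff a = 0) :
    theta (-a) (-a ^ 2) = qPochhammerInf a a := by
  rw [theta_neg_neg_eq_qPochhammerInf ha (by simp [ha]), qPochhammerInf_eq_mul_mul a ha]
  ring_nf

theorem theta_self_mul_theta_neg_self (ha : constantCoeff a = 0) :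
    theta a a * theta (-a) (-a) = theta (-a ^ 2) (-a ^ 2) ^ 2 := by
  have ha2 : constantCoeff (a ^ 2) = 0 := by simp [ha]
  rw [theta_self_eq_qPochhammerInf ha, theta_neg_self_eq_qPochhammerInf ha,
    theta_neg_self_eq_qPochhammerInf ha2, ← qPochhammerInf_mul_qPochhammerInf_neg a ha2,
    qPochhammerInf_self_eq_mul ha2, ← qPochhammerInf_mul_qPochhammerInf_neg a ha2]
  ring

theorem theta_neg_neg_sq_mul_theta_pow_three (ha : constantCoeff a = 0) :
    theta (-a) (-a ^ 2) * theta a (a ^ 3) = theta (-a ^ 2) (-a ^ 4) ^ 2 := by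
  have ha2 : constantCoeff (a ^ 2) = 0 := by simp [ha]
  have h : theta (-a ^ 2) (-a ^ 4) = qPochhammerInf (a ^ 2) (a ^ 2) := by
    simpa only [← pow_mul, Nat.reduceMul] using theta_neg_neg_sq_eq_qPochhammerInf ha2
  rw [h, theta_neg_neg_sq_eq_qPochhammerInf ha, theta_pow_three_eq_qPochhammerInf ha,
    qPochhammerInf_self_eq_mul ha, qPochhammerInf_self_eq_mul ha2,
    ← qPochhammerInf_mul_qPochhammerInf_neg a ha2, ← pow_mul]
  ring

theorem theta_neg_neg_sq_mul_theta_neg_neg_pow_five (ha : constantCoeff a = 0) :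
    theta (-a) (-a ^ 2) * theta (-a) (-a ^ 5) = theta (-a) (-a) * theta (a ^ 3) (a ^ 9) := by
  have hpsi : theta (a ^ 3) (a ^ 9) =
      qPochhammerInf (-a ^ 3) (a ^ 6) * qPochhammerInf (a ^ 12) (a ^ 12) := by
    have h := theta_pow_three_eq_qPochhammerInf (a := a ^ 3) (by simp [ha])
    simpa only [← pow_mul, Nat.reduceMul] using h
  have hsplit : qPochhammerInf a (a ^ 2) =
      qPochhammerInf a (a ^ 6) * qPochhammerInf (a ^ 3) (a ^ 6) *
        qPochhammerInf (a ^ 5) (a ^ 6) := by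
    have h := qPochhammerInf_eq_mul_mul a (q := a ^ 2) (by simp [ha])
    simpa only [← pow_mul, ← pow_succ', Nat.reduceMul, Nat.reduceAdd] using h
  have heven : qPochhammerInf (a ^ 6) (a ^ 6) =
      qPochhammerInf (a ^ 6) (a ^ 12) * qPochhammerInf (a ^ 12) (a ^ 12) := by
    have h := qPochhammerInf_self_eq_mul (a := a ^ 6) (by simp [ha])
    simpa only [← pow_mul, Nat.reduceMul] using h
  have hneg : qPochhammerInf (a ^ 3) (a ^ 6) * qPochhammerInf (-a ^ 3) (a ^ 6) =
      qPochhammerInf (a ^ 6) (a ^ 12) := by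
    have h := qPochhammerInf_mul_qPochhammerInf_neg (a ^ 3) (q := a ^ 6) (by simp [ha])
    simpa only [← pow_mul, Nat.reduceMul] using h
  rw [theta_neg_neg_sq_eq_qPochhammerInf ha, qPochhammerInf_self_eq_mul ha,
    theta_neg_self_eq_qPochhammerInf ha, theta_neg_neg_eq_qPochhammerInf ha (by simp [ha]),
    ← pow_succ', hpsi, heven, ← hneg, hsplit]
  ring

theorem theta_neg_self_mul_theta_sq (ha : constantCoeff a = 0) :
    theta (-a) (-a) * theta a (a ^ 2) = theta (-a) (-a ^ 2) * theta (-a ^ 3) (-a ^ 3) := by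
  have ha3 : constantCoeff (a ^ 3) = 0 := by simp [ha]
  have hsplit := qPochhammerInf_eq_mul_mul (-a) ha
  have ha1 := qPochhammerInf_sq_mul_qPochhammerInf_neg ha
  have ha3' := qPochhammerInf_sq_mul_qPochhammerInf_neg ha3
  rw [theta_neg_self_eq_qPochhammerInf ha, theta_neg_self_eq_qPochhammerInf ha3,
    theta_neg_neg_sq_eq_qPochhammerInf ha, qPochhammerInf_self_eq_mul ha,
    theta_eq_qPochhammerInf ha (by simp [ha]), ← pow_succ', qPochhammerInf_self_eq_mul ha3]
  rw [neg_mul, neg_mul, ← sq, ← pow_succ'] at hsplit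
  rw [hsplit] at ha1
  refine (isUnit_qPochhammerInf (a := -a ^ 3) (by simp [ha]) ha3).mul_left_cancel ?_
  linear_combination qPochhammerInf a (a ^ 2) * qPochhammerInf (a ^ 2) (a ^ 2) *
    qPochhammerInf (a ^ 3) ((a ^ 3) ^ 2) * qPochhammerInf ((a ^ 3) ^ 2) ((a ^ 3) ^ 2) *
    (ha1 - ha3')

theorem theta_self_mul_qPochhammerInf (ha : constantCoeff a = 0) :
    theta a a * qPochhammerInf a (a ^ 2) =
      theta (-a ^ 2) (-a ^ 2) * qPochhammerInf (-a) (a ^ 2) := by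
  have ha2 : constantCoeff (a ^ 2) = 0 := by simp [ha]
  rw [theta_self_eq_qPochhammerInf ha, theta_neg_self_eq_qPochhammerInf ha2,
    qPochhammerInf_self_eq_mul ha2, ← qPochhammerInf_mul_qPochhammerInf_neg a ha2]
  ring

end ProductIdentities

section ProgSection

variable {R : Type*} [CommRing R]

/-- The section `∑ n, A_{a n + r} X ^ n` of a power series `A` along the arithmetic progression
`a n + r`. -/
noncomputable def progSection (a r : ℕ) : R⟦X⟧ →ₗ[R] R⟦X⟧ where
  toFun A := mk fun n => coeff (a * n + r) A
  map_add' A B := by ext n; simp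
  map_smul' c A := by ext n; simp

@[simp]
theorem coeff_progSection (a r n : ℕ) (A : R⟦X⟧) :
    coeff n (progSection a r A) = coeff (a * n + r) A := by
  simp [progSection]

theorem progSection_comp (a r b s : ℕ) (A : R⟦X⟧) :
    progSection b s (progSection a r A) = progSection (a * b) (a * s + r) A := by
  ext n
  simp only [coeff_progSection]
  ring_nf

theorem progSection_ofNat_mul (a r k : ℕ) [k.AtLeastTwo] (A : R⟦X⟧) :
    progSection a r (ofNat(k) * A) = ofNat(k) * progSection a r A := by
  simp only [← Nat.cast_ofNat (R := R⟦X⟧), ← nsmul_eq_mul, map_nsmul]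

theorem ofNat_dvd_progSection (a r k : ℕ) [k.AtLeastTwo] {A : R⟦X⟧}
    (h : (ofNat(k) : R⟦X⟧) ∣ A) : (ofNat(k) : R⟦X⟧) ∣ progSection a r A := by
  obtain ⟨Z, rfl⟩ := h
  exact ⟨progSection a r Z, progSection_ofNat_mul a r k Z⟩

theorem coeff_X_pow_mul_expand {a : ℕ} (ha : a ≠ 0) (n j : ℕ) (A : R⟦X⟧) :
    coeff (a * n + j) (X ^ j * expand a ha A) = coeff n A := by
  rw [coeff_X_pow_mul, coeff_expand_mul]

theorem coeff_X_pow_mul_expand_of_not_modEq {a : ℕ} (ha : a ≠ 0) {n j : ℕ}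
    (h : ¬ n ≡ j [MOD a]) (A : R⟦X⟧) : coeff n (X ^ j * expand a ha A) = 0 := by
  rw [coeff_X_pow_mul']
  split_ifs with hj
  · exact coeff_expand_of_not_dvd _ _ _ fun hd => h ((Nat.modEq_iff_dvd' hj).2 hd).symm
  · rfl

theorem progSection_X_pow_mul_expand {a b c r s j : ℕ} (ha : a ≠ 0) (hc : c = a * b)
    (hs : s = a * r + j) (A : R⟦X⟧) :
    progSection c s (X ^ j * expand a ha A) = progSection b r A := by
  ext n
  rw [hc, hs, coeff_progSection, coeff_progSection,
    show a * b * n + (a * r + j) = a * (b * n + r) + j by ring, coeff_X_pow_mul_expand]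

theorem progSection_X_pow_mul_expand_self {a : ℕ} (ha : a ≠ 0) (j : ℕ) (A : R⟦X⟧) :
    progSection a j (X ^ j * expand a ha A) = A := by
  ext n
  rw [coeff_progSection, coeff_X_pow_mul_expand]

theorem progSection_X_pow_mul_expand_eq_zero {a b r j : ℕ} (hb : b ≠ 0) (hba : b ∣ a)
    (h : ¬ r ≡ j [MOD b]) (A : R⟦X⟧) : progSection a r (X ^ j * expand b hb A) = 0 := by
  ext n
  rw [coeff_progSection, map_zero]
  refine coeff_X_pow_mul_expand_of_not_modEq hb (fun h' => h (Nat.ModEq.trans ?_ h')) A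
  simpa using (Nat.modEq_zero_iff_dvd.2 (hba.mul_right n)).symm.add_right r

theorem sum_X_pow_mul_expand_progSection {a : ℕ} (ha : a ≠ 0) (A : R⟦X⟧) :
    ∑ j ∈ Finset.range a, X ^ j * expand a ha (progSection a j A) = A := by
  ext n
  rw [map_sum, Finset.sum_eq_single_of_mem (n % a)
    (Finset.mem_range.2 (Nat.mod_lt n (Nat.pos_of_ne_zero ha)))]
  · have h := coeff_X_pow_mul_expand ha (n / a) (n % a) (progSection a (n % a) A)
    rwa [coeff_progSection, Nat.div_add_mod] at h
  · intro j hj hne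
    refine coeff_X_pow_mul_expand_of_not_modEq ha (fun h => hne ?_) _
    exact ((Nat.mod_eq_of_lt (Finset.mem_range.1 hj)).symm.trans h.symm)

theorem progSection_mul_expand {a r : ℕ} (ha : a ≠ 0) (hr : r < a) (A B : R⟦X⟧) :
    progSection a r (A * expand a ha B) = progSection a r A * B := by
  conv_lhs => rw [← sum_X_pow_mul_expand_progSection ha A, Finset.sum_mul, map_sum]
  simp only [mul_assoc, ← map_mul]
  rw [Finset.sum_eq_single_of_mem r (Finset.mem_range.2 hr),
    progSection_X_pow_mul_expand_self]
  intro j hj hne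
  refine progSection_X_pow_mul_expand_eq_zero ha dvd_rfl (fun h => hne ?_) _
  exact (h.eq_of_lt_of_lt hr (Finset.mem_range.1 hj)).symm

end ProgSection

section Dissections

variable {R : Type*} [CommRing R] [TopologicalSpace R] [IsTopologicalRing R] [T2Space R]
  {a b c : R⟦X⟧}

theorem theta_self_eq_add (ha : constantCoeff a = 0) :
    theta a a = theta (a ^ 9) (a ^ 9) + 2 * (a * theta (a ^ 3) (a ^ 15)) := by
  rw [theta_eq_theta_add_mul_theta_add_mul_theta ha ha, theta_comm _ (a ^ 3)]
  ring_nf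

theorem theta_pow_three_eq_add (ha : constantCoeff a = 0) :
    theta a (a ^ 3) = theta (a ^ 3) (a ^ 6) + a * theta (a ^ 9) (a ^ 27) := by
  have ha3 : constantCoeff (a ^ 3) = 0 := by simp [ha]
  have htwo := theta_eq_theta_add_mul_theta ha3 ha3
  have hthree := theta_eq_theta_add_mul_theta_add_mul_theta ha ha3
  rw [theta_comm _ ((a ^ 3) ^ 3)] at hthree
  ring_nf at htwo hthree ⊢
  rw [htwo, hthree]
  ring

theorem theta_neg_neg_pow_five_eq_sub (ha : constantCoeff a = 0) :
    theta (-a) (-a ^ 5) = theta (a ^ 8) (a ^ 16) - a * theta (a ^ 4) (a ^ 20) := by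
  have h := theta_eq_theta_add_mul_theta (a := -a) (c := a ^ 4) (by simpa) (by simp [ha])
  ring_nf at h ⊢
  exact h

theorem theta_pow_five_mul_theta_neg (ha : constantCoeff a = 0) :
    theta a (a ^ 5) * theta (-a ^ 3) (-a ^ 3) =
      theta (-a ^ 4) (-a ^ 8) ^ 2 + a * theta (-a ^ 2) (-a ^ 10) ^ 2 := by
  have h := theta_mul_theta_parity (x := -a ^ 2) (y := -a ^ 2) ha (by simp [ha]) (by simp [ha])
  ring_nf at h ⊢
  exact h

theorem two_dvd_theta_sub_theta_neg_neg (ha : constantCoeff a = 0) (hc : constantCoeff c = 0) :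
    2 ∣ theta a (a * c) - theta (-a) (-(a * c)) := by
  have h := theta_eq_theta_add_mul_theta (a := -a) (by simpa) hc
  rw [Even.neg_pow (by decide), Even.neg_pow (by decide), neg_mul] at h
  rw [theta_eq_theta_add_mul_theta ha hc, h]
  exact ⟨a * theta c (a ^ 8 * c ^ 3), by ring⟩

theorem two_dvd_theta_self_sub_one (ha : constantCoeff a = 0) : 2 ∣ theta a a - 1 := by
  have hneg (n : ℤ) : thetaTerm a a (-n) = thetaTerm a a n := by
    rw [thetaTerm, thetaTerm, neg_neg, mul_comm]
  obtain ⟨S, hS⟩ : Summable fun n : ℕ => thetaTerm a a (n + 1) := by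
    refine summable_of_X_pow_dvd (fun n : ℕ => (pow_dvd_pow X ?_).trans
      (X_pow_dvd_thetaTerm ha ha _)) Set.finite_le_nat
    exact (Nat.le_self_pow two_ne_zero _).trans (Nat.pow_le_pow_left (by omega) 2)
  have hnat : HasSum (fun n : ℕ => thetaTerm a a n) (thetaTerm a a 0 + S) :=
    HasSum.zero_add (f := fun n : ℕ => thetaTerm a a n) (by simpa using hS)
  have hint := hnat.of_nat_of_neg_add_one (by simpa only [hneg] using hS)
  refine ⟨S, ?_⟩
  rw [(hasSum_theta ha ha).unique hint, thetaTerm, neg_zero, triangle_zero]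
  ring

end Dissections

section ThetaQuot

variable {R : Type*} [CommRing R] [TopologicalSpace R]

/-- The quotient `f(a, a ^ 5) / f(a ^ 3, a ^ 3)`, which governs the 3-dissection
`theta_self_eq_theta_mul` of `f(a, a)`. -/
noncomputable def thetaQuot (a : R⟦X⟧) : R⟦X⟧ :=
  theta a (a ^ 5) * Ring.inverse (theta (a ^ 3) (a ^ 3))

variable [IsTopologicalRing R] [T2Space R] {a : R⟦X⟧}

theorem thetaQuot_mul_theta (ha : constantCoeff a = 0) :
    thetaQuot a * theta (a ^ 3) (a ^ 3) = theta a (a ^ 5) := by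
  have ha3 : constantCoeff (a ^ 3) = 0 := by simp [ha]
  rw [thetaQuot, mul_assoc, Ring.inverse_mul_cancel _ (isUnit_theta ha3 ha3), mul_one]

theorem expand_thetaQuot (ha : constantCoeff a = 0) (k : ℕ) (hk : k ≠ 0) :
    expand k hk (thetaQuot a) = thetaQuot (expand k hk a) := by
  have ha' : constantCoeff (expand k hk a) = 0 := by simpa
  refine (isUnit_theta (a := expand k hk a ^ 3) (b := expand k hk a ^ 3) (by simp [ha])
    (by simp [ha])).mul_right_cancel ?_
  have h := congrArg (expand k hk) (thetaQuot_mul_theta ha)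
  rw [map_mul, expand_theta (by simp [ha]) (by simp [ha]), expand_theta ha (by simp [ha])] at h
  simpa only [map_pow, thetaQuot_mul_theta ha'] using h

theorem theta_self_eq_theta_mul (ha : constantCoeff a = 0) :
    theta a a = theta (a ^ 9) (a ^ 9) * (1 + 2 * a * thetaQuot (a ^ 3)) := by
  have h := thetaQuot_mul_theta (a := a ^ 3) (by simp [ha])
  simp only [← pow_mul, Nat.reduceMul] at h
  rw [theta_self_eq_add ha, ← h]
  ring

end ThetaQuot

section SchurSeries

theorem mod_two_mul_mem_schurResidues {t : ℕ} (ht : Odd t) (m : ℕ) :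
    m % (2 * t) ∈ schurResidues t ↔ Odd m ∧ ¬ t ∣ m := by
  have hmod : m % (2 * t) < 2 * t := Nat.mod_lt m (by have := ht.pos; omega)
  have hodd : Odd (m % (2 * t)) ↔ Odd m := by
    rw [Nat.odd_iff, Nat.mod_mul_right_mod, ← Nat.odd_iff]
  rw [schurResidues, Finset.mem_filter, Finset.mem_range, hodd, and_iff_right hmod]
  refine and_congr_right fun hm => not_congr ⟨fun h => ?_, fun h => ?_⟩
  · rw [← Nat.dvd_mod_iff (dvd_mul_left t 2), h]
  · obtain ⟨k, hk⟩ := (Nat.dvd_mod_iff (dvd_mul_left t 2)).2 h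
    have hk2 : k < 2 := by
      rw [hk, mul_comm] at hmod
      exact lt_of_mul_lt_mul_right hmod t.zero_le
    interval_cases k
    · rw [hk, mul_zero] at hodd
      exact absurd (hodd.2 hm) (by decide)
    · rwa [mul_one] at hk

/-- The generating function of the numbers of `t`-Schur overpartitions. -/
noncomputable def schurSeries (t : ℕ) : ℤ⟦X⟧ :=
  mk fun n => (numSchurOverpartitions t n : ℤ)

theorem coeff_schurSeries_pow (t r n : ℕ) :
    coeff n (schurSeries t ^ r) = numSchurOverpartitionTuples t r n := by
  have h := coeff_prod (fun _ : Fin r => schurSeries t) n Finset.univ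
  rw [Finset.prod_const, Finset.card_univ, Fintype.card_fin] at h
  rw [h, numSchurOverpartitionTuples, schurOverpartitionTuples, Finset.card_sigma, Nat.cast_sum]
  refine Finset.sum_nbij' (fun k => k) (fun k => Finsupp.equivFunOnFinite.symm k)
    (fun k hk => ?_) (fun k hk => ?_) (fun k _ => by ext; rfl) (fun k _ => rfl) fun k _ => ?_
  · exact Finset.Nat.mem_antidiagonalTuple.2 (Finset.mem_finsuppAntidiag.1 hk).1
  · exact Finset.mem_finsuppAntidiag.2
      ⟨by simpa using Finset.Nat.mem_antidiagonalTuple.1 hk, Finset.subset_univ _⟩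
  · simp only [Fintype.card_piFinset, Nat.cast_prod, schurSeries, coeff_mk,
      numSchurOverpartitions]

theorem card_schurOverpartitions (t n : ℕ) :
    ((schurOverpartitions t n).card : ℤ) = ∑ μ : n.Partition,
      μ.parts.toFinsupp.prod fun i _ => if i % (2 * t) ∈ schurResidues t then 2 else 0 := by
  rw [schurOverpartitions, Finset.card_sigma, schurPartitions, Finset.sum_filter, Nat.cast_sum]
  refine Finset.sum_congr rfl fun μ _ => ?_
  rw [Finsupp.prod, Multiset.toFinsupp_support]
  split_ifs with h
  · rw [Finset.prod_congr rfl fun i hi => if_pos (h i (Multiset.mem_toFinset.1 hi)),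
      Finset.prod_const, Finset.card_powerset, Nat.cast_pow, Nat.cast_ofNat]
  · push Not at h
    obtain ⟨i, hi, hres⟩ := h
    rw [Finset.prod_eq_zero (Multiset.mem_toFinset.2 hi) (if_neg hres), Nat.cast_zero]

theorem schurSeries_eq_genFun (t : ℕ) :
    schurSeries t =
      Nat.Partition.genFun fun i _ => if i % (2 * t) ∈ schurResidues t then (2 : ℤ) else 0 := by
  ext n
  rw [schurSeries, coeff_mk, numSchurOverpartitions, card_schurOverpartitions,
    Nat.Partition.coeff_genFun]

theorem one_add_tsum_two_mul_pow_mul_one_sub {a : ℤ⟦X⟧} (ha : constantCoeff a = 0) :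
    (1 + ∑' j : ℕ, 2 * a ^ (j + 1)) * (1 - a) = 1 + a := by
  have hgeom := WithPiTopology.tsum_pow_mul_one_sub_of_constantCoeff_eq_zero ha
  have hsum := WithPiTopology.summable_pow_of_constantCoeff_eq_zero ha
  have htsum : ∑' j : ℕ, 2 * a ^ (j + 1) = 2 * a * ∑' j : ℕ, a ^ j := by
    simp only [← hsum.tsum_mul_left, pow_succ', mul_assoc]
  rw [htsum]
  linear_combination 2 * a * hgeom

theorem hasProd_schurSeries {t : ℕ} (ht : Odd t) :
    HasProd (fun k : ℕ => if t ∣ 2 * k + 1 then (1 : ℤ⟦X⟧) else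
      1 + ∑' j : ℕ, 2 * (X ^ (2 * k + 1)) ^ (j + 1)) (schurSeries t) := by
  have hgen := Nat.Partition.hasProd_genFun
    fun i _ => if i % (2 * t) ∈ schurResidues t then (2 : ℤ) else 0
  rw [← schurSeries_eq_genFun] at hgen
  simp only [mod_two_mul_mem_schurResidues ht, smul_eq_C_mul, pow_mul] at hgen
  rw [← (mul_right_injective₀ (two_ne_zero' ℕ)).hasProd_iff] at hgen
  · refine hgen.congr_fun fun k => ?_
    simp only [Function.comp_apply, odd_two_mul_add_one, true_and]
    split_ifs <;> simp [*]
  · intro i hi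
    have hodd : ¬ Odd (i + 1) := by
      rintro ⟨k, hk⟩
      exact hi ⟨k, by simp only; omega⟩
    simp [hodd]

theorem hasProd_ite_dvd {M : Type*} [CommMonoid M] [TopologicalSpace M] {t : ℕ} (ht : Odd t)
    {f : ℕ → M} {A : M} (hf : HasProd (fun k => f (t * (2 * k + 1))) A) :
    HasProd (fun k => if t ∣ 2 * k + 1 then f (2 * k + 1) else 1) A := by
  obtain ⟨s, rfl⟩ := ht
  have hs (k : ℕ) : 2 * ((2 * s + 1) * k + s) + 1 = (2 * s + 1) * (2 * k + 1) := by ring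
  have hinj : (fun k : ℕ => (2 * s + 1) * k + s).Injective := fun m n h => by simpa using h
  rw [← hinj.hasProd_iff]
  · simpa only [Function.comp_def, hs, dvd_mul_right, if_true] using hf
  · intro k hk
    rw [if_neg]
    rintro ⟨d, hd⟩
    obtain ⟨e, rfl⟩ : Odd d := (Nat.odd_mul.1 (hd ▸ odd_two_mul_add_one k)).2
    exact hk ⟨e, by have := hs e; simp only; omega⟩

theorem schurSeries_mul_qPochhammerInf {t : ℕ} (ht : Odd t) :
    schurSeries t * qPochhammerInf X (X ^ 2) * qPochhammerInf (-X ^ t) ((X ^ t) ^ 2) =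
      qPochhammerInf (-X) (X ^ 2) * qPochhammerInf (X ^ t) ((X ^ t) ^ 2) := by
  have hX (a : ℤ⟦X⟧) := hasProd_qPochhammerInf a (q := X ^ 2) (by simp)
  have hXt (a : ℤ⟦X⟧) := hasProd_qPochhammerInf a (q := (X ^ t) ^ 2) (by simp [ht.pos.ne'])
  have hneg := hasProd_ite_dvd ht (f := fun m => (1 + X ^ m : ℤ⟦X⟧))
    (A := qPochhammerInf (-X ^ t) ((X ^ t) ^ 2)) (by convert hXt _ using 2; ring)
  have hpos := hasProd_ite_dvd ht (f := fun m => (1 - X ^ m : ℤ⟦X⟧))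
    (A := qPochhammerInf (X ^ t) ((X ^ t) ^ 2)) (by convert hXt _ using 2; ring)
  refine (((hasProd_schurSeries ht).mul (hX X)).mul hneg).unique ?_
  convert (hX (-X)).mul hpos using 2 with k
  rw [← pow_mul, neg_mul, sub_neg_eq_add, ← pow_succ']
  split_ifs
  · ring
  · rw [one_add_tsum_two_mul_pow_mul_one_sub (by simp)]

theorem schurSeries_mul_theta {t : ℕ} (ht : Odd t) :
    schurSeries t * theta (X ^ t) (X ^ t) * theta (-X ^ 2) (-X ^ 2) =
      theta X X * theta (-(X ^ t) ^ 2) (-(X ^ t) ^ 2) := by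
  have hXt : constantCoeff (X ^ t : ℤ⟦X⟧) = 0 := by simp [ht.pos.ne']
  have hX : constantCoeff (X : ℤ⟦X⟧) = 0 := by simp
  have hunit := (isUnit_qPochhammerInf (a := X ^ t) (q := (X ^ t) ^ 2) hXt (by simp [hXt])).mul
    (isUnit_qPochhammerInf (a := (X : ℤ⟦X⟧)) (q := X ^ 2) hX (by simp))
  refine hunit.mul_left_cancel ?_
  linear_combination theta (-X ^ 2) (-X ^ 2) * qPochhammerInf X (X ^ 2) * schurSeries t *
      theta_self_mul_qPochhammerInf hXt + theta (-X ^ 2) (-X ^ 2) *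
      theta (-(X ^ t) ^ 2) (-(X ^ t) ^ 2) * schurSeries_mul_qPochhammerInf ht -
      theta (-(X ^ t) ^ 2) (-(X ^ t) ^ 2) * qPochhammerInf (X ^ t) ((X ^ t) ^ 2) *
        theta_self_mul_qPochhammerInf hX

theorem schurSeries_nine_mul_one_sub :
    schurSeries 9 * (1 - 2 * (X ^ 2 * expand 6 (by decide) (thetaQuot (-X)))) =
      1 + 2 * (X * expand 3 (by decide) (thetaQuot X)) := by
  have hF := schurSeries_mul_theta (t := 9) (by decide)
  have hX := theta_self_eq_theta_mul (a := (X : ℤ⟦X⟧)) (by simp)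
  have hX2 := theta_self_eq_theta_mul (a := (-X ^ 2 : ℤ⟦X⟧)) (by simp)
  rw [expand_thetaQuot (by simp), expand_thetaQuot (by simp), map_neg, expand_X, expand_X]
  simp only [Odd.neg_pow (show Odd 9 by decide), Odd.neg_pow (show Odd 3 by decide), ← pow_mul,
    Nat.reduceMul] at hF hX hX2
  rw [hX, hX2] at hF
  refine ((isUnit_theta (a := (X ^ 9 : ℤ⟦X⟧)) (b := X ^ 9) (by simp) (by simp)).mul
    (isUnit_theta (a := (-X ^ 18 : ℤ⟦X⟧)) (b := -X ^ 18) (by simp) (by simp))).mul_left_cancel ?_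
  linear_combination hF

end SchurSeries

section SectionsModSix

theorem progSection_two_zero_thetaQuot_mul :
    progSection 2 0 (thetaQuot (X : ℤ⟦X⟧)) * theta (-X ^ 3) (-X ^ 3) ^ 2 =
      theta (-X ^ 2) (-X ^ 4) ^ 2 := by
  have hprod := theta_self_mul_theta_neg_self (a := (X ^ 3 : ℤ⟦X⟧)) (by simp)
  have hquot := thetaQuot_mul_theta (a := (X : ℤ⟦X⟧)) (by simp)
  have hpar := theta_pow_five_mul_theta_neg (a := (X : ℤ⟦X⟧)) (by simp)
  have hsplit : thetaQuot X * expand 2 two_ne_zero (theta (-X ^ 3) (-X ^ 3) ^ 2) =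
      X ^ 0 * expand 2 two_ne_zero (theta (-X ^ 2) (-X ^ 4) ^ 2) +
        X ^ 1 * expand 2 two_ne_zero (theta (-X) (-X ^ 5) ^ 2 : ℤ⟦X⟧) := by
    simp only [map_pow, expand_theta, map_neg, expand_X, ← pow_mul, constantCoeff_X, ne_eq,
      OfNat.ofNat_ne_zero, not_false_eq_true, zero_pow, neg_zero, Nat.reduceMul] at hprod ⊢
    linear_combination hpar + theta (-X ^ 3) (-X ^ 3) * hquot - thetaQuot X * hprod
  rw [← progSection_mul_expand two_ne_zero two_pos, hsplit, map_add,
    progSection_X_pow_mul_expand_self,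
    progSection_X_pow_mul_expand_eq_zero two_ne_zero dvd_rfl (by decide), add_zero]

theorem schurSeries_nine_mul_expand_six :
    schurSeries 9 * expand 6 (by decide) (1 - 8 * X * thetaQuot (-X) ^ 3) =
      X ^ 0 * expand 6 (by decide) 1 +
      2 * (X ^ 1 * expand 3 (by decide) (thetaQuot X)) +
      2 * (X ^ 2 * expand 6 (by decide) (thetaQuot (-X))) +
      4 * (X ^ 3 * expand 3 (by decide)
        (thetaQuot X * expand 2 (by decide) (thetaQuot (-X)))) +
      4 * (X ^ 4 * expand 6 (by decide) (thetaQuot (-X) ^ 2)) +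
      8 * (X ^ 5 * expand 3 (by decide)
        (thetaQuot X * expand 2 (by decide) (thetaQuot (-X) ^ 2))) := by
  have hexpand (A : ℤ⟦X⟧) : expand 3 (by decide) (expand 2 (by decide) A) =
    expand 6 (by decide) A := (expand_mul 3 (by decide) 2 (by decide) A).symm
  simp only [map_mul, map_sub, map_pow, map_one, map_ofNat, expand_X, hexpand]
  set V := expand 6 (by decide) (thetaQuot (-X : ℤ⟦X⟧))
  linear_combination (1 + 2 * X ^ 2 * V + 4 * X ^ 4 * V ^ 2) * schurSeries_nine_mul_one_sub

theorem progSection_six_one_schurSeries_nine_mul :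
    progSection 6 1 (schurSeries 9) * (1 - 8 * X * thetaQuot (-X) ^ 3) =
      2 * progSection 2 0 (thetaQuot X) := by
  rw [← progSection_mul_expand (by decide) (by decide), schurSeries_nine_mul_expand_six]
  simp only [map_add, progSection_ofNat_mul]
  rw [progSection_X_pow_mul_expand_eq_zero (j := 0) (by decide) (by decide) (by decide),
    progSection_X_pow_mul_expand (c := 6) (s := 1) (b := 2) (r := 0) three_ne_zero rfl rfl,
    progSection_X_pow_mul_expand_eq_zero (j := 2) (by decide) (by decide) (by decide),
    progSection_X_pow_mul_expand_eq_zero (j := 3) (by decide) (by decide) (by decide),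
    progSection_X_pow_mul_expand_eq_zero (j := 4) (by decide) (by decide) (by decide),
    progSection_X_pow_mul_expand_eq_zero (j := 5) (by decide) (by decide) (by decide)]
  ring

theorem progSection_six_three_schurSeries_nine_mul :
    progSection 6 3 (schurSeries 9) * (1 - 8 * X * thetaQuot (-X) ^ 3) =
      4 * (progSection 2 0 (thetaQuot X) * thetaQuot (-X)) := by
  rw [← progSection_mul_expand (by decide) (by decide), schurSeries_nine_mul_expand_six]
  simp only [map_add, progSection_ofNat_mul]
  rw [progSection_X_pow_mul_expand_eq_zero (j := 0) (by decide) (by decide) (by decide),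
    progSection_X_pow_mul_expand_eq_zero (j := 1) (by decide) (by decide) (by decide),
    progSection_X_pow_mul_expand_eq_zero (j := 2) (by decide) (by decide) (by decide),
    progSection_X_pow_mul_expand (c := 6) (s := 3) (b := 2) (r := 0) three_ne_zero rfl rfl,
    progSection_X_pow_mul_expand_eq_zero (j := 4) (by decide) (by decide) (by decide),
    progSection_X_pow_mul_expand_eq_zero (j := 5) (by decide) (by decide) (by decide),
    progSection_mul_expand two_ne_zero two_pos]
  ring

theorem progSection_six_five_schurSeries_nine_mul :
    progSection 6 5 (schurSeries 9) * (1 - 8 * X * thetaQuot (-X) ^ 3) =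
      8 * (progSection 2 0 (thetaQuot X) * thetaQuot (-X) ^ 2) := by
  rw [← progSection_mul_expand (by decide) (by decide), schurSeries_nine_mul_expand_six]
  simp only [map_add, progSection_ofNat_mul]
  rw [progSection_X_pow_mul_expand_eq_zero (j := 0) (by decide) (by decide) (by decide),
    progSection_X_pow_mul_expand_eq_zero (j := 1) (by decide) (by decide) (by decide),
    progSection_X_pow_mul_expand_eq_zero (j := 2) (by decide) (by decide) (by decide),
    progSection_X_pow_mul_expand_eq_zero (j := 3) (by decide) (by decide) (by decide),
    progSection_X_pow_mul_expand_eq_zero (j := 4) (by decide) (by decide) (by decide),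
    progSection_X_pow_mul_expand (c := 6) (s := 5) (b := 2) (r := 0) three_ne_zero rfl rfl,
    progSection_mul_expand two_ne_zero two_pos]
  ring

end SectionsModSix

section Congruences

theorem C_dvd_iff_forall_dvd_coeff {R : Type*} [CommSemiring R] {c : R} {A : R⟦X⟧} :
    C c ∣ A ↔ ∀ n, c ∣ coeff n A := by
  refine ⟨fun ⟨Z, hZ⟩ n => ⟨coeff n Z, by rw [hZ, coeff_C_mul]⟩, fun h => ?_⟩
  choose z hz using h
  exact ⟨mk z, by ext n; rw [coeff_C_mul, coeff_mk, hz]⟩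

theorem natCast_dvd_pow_sub_expand (p : ℕ) [hp : Fact p.Prime] (A : ℤ⟦X⟧) :
    (p : ℤ⟦X⟧) ∣ A ^ p - expand p hp.out.ne_zero A := by
  have hzmod : map (Int.castRingHom (ZMod p)) (A ^ p - expand p hp.out.ne_zero A) = 0 := by
    have hfrob := MvPowerSeries.map_frobenius_expand p hp.out.ne_zero
      (f := map (Int.castRingHom (ZMod p)) A)
    rw [ZMod.frobenius_zmod, MvPowerSeries.map_id] at hfrob
    rw [map_sub, map_pow, map_expand, sub_eq_zero]
    exact hfrob.symm
  rw [← map_natCast C, C_dvd_iff_forall_dvd_coeff]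
  intro n
  rw [← ZMod.intCast_zmod_eq_zero_iff_dvd]
  simpa only [coeff_map, eq_intCast, map_zero] using congrArg (coeff n) hzmod

theorem two_dvd_sq_sub_expand (A : ℤ⟦X⟧) : 2 ∣ A ^ 2 - expand 2 two_ne_zero A :=
  natCast_dvd_pow_sub_expand 2 A

theorem three_dvd_pow_three_sub_expand (A : ℤ⟦X⟧) : 3 ∣ A ^ 3 - expand 3 three_ne_zero A :=
  natCast_dvd_pow_sub_expand 3 A

theorem thetaQuot_neg_X_mul_theta :
    thetaQuot (-X : ℤ⟦X⟧) * theta (-X ^ 3) (-X ^ 3) = theta (-X) (-X ^ 5) := by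
  simpa only [Odd.neg_pow (show Odd 3 by decide), Odd.neg_pow (show Odd 5 by decide)] using
    thetaQuot_mul_theta (a := (-X : ℤ⟦X⟧)) (by simp)

theorem theta_neg_X_self_eq_theta_mul :
    theta (-X) (-X) = theta (-X ^ 9) (-X ^ 9) *
      (1 - 2 * X * expand 3 three_ne_zero (thetaQuot (-X : ℤ⟦X⟧))) := by
  have h := theta_self_eq_theta_mul (a := (-X : ℤ⟦X⟧)) (by simp)
  rw [expand_thetaQuot (by simp), map_neg, expand_X]
  rw [Odd.neg_pow (show Odd 3 by decide), Odd.neg_pow (show Odd 9 by decide)] at h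
  linear_combination h

theorem progSection_two_zero_thetaQuot_mul_thetaQuot :
    progSection 2 0 (thetaQuot (X : ℤ⟦X⟧)) * thetaQuot (-X) * theta (-X ^ 3) (-X ^ 3) ^ 3 =
      theta (-X) (-X) * theta X (X ^ 3) * theta (X ^ 3) (X ^ 9) := by
  have hX : constantCoeff (X : ℤ⟦X⟧) = 0 := by simp
  linear_combination thetaQuot (-X) * theta (-X ^ 3) (-X ^ 3) *
      progSection_two_zero_thetaQuot_mul + theta (-X ^ 2) (-X ^ 4) ^ 2 *
      thetaQuot_neg_X_mul_theta - theta (-X) (-X ^ 5) * theta_neg_neg_sq_mul_theta_pow_three hX +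
      theta X (X ^ 3) * theta_neg_neg_sq_mul_theta_neg_neg_pow_five hX

theorem three_dvd_progSection_six_three_sub :
    3 ∣ progSection 6 3 (schurSeries 9) - theta X (X ^ 3) * theta (X ^ 3) (X ^ 9) := by
  have hsec := progSection_six_three_schurSeries_nine_mul
  have htheta := theta_neg_X_self_eq_theta_mul
  have hprod := progSection_two_zero_thetaQuot_mul_thetaQuot
  have hexpand : expand 3 three_ne_zero (theta (-X ^ 3 : ℤ⟦X⟧) (-X ^ 3)) =
      theta (-X ^ 9) (-X ^ 9) := by
    rw [expand_theta (by simp) (by simp), map_neg, map_pow, expand_X, ← pow_mul]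
  obtain ⟨Z, hZ⟩ := three_dvd_pow_three_sub_expand (thetaQuot (-X))
  obtain ⟨Y, hY⟩ := three_dvd_pow_three_sub_expand (theta (-X ^ 3) (-X ^ 3))
  rw [hexpand] at hY
  rw [← (isUnit_theta (a := (-X : ℤ⟦X⟧)) (b := -X) (by simp) (by simp)).dvd_mul_left]
  generalize progSection 6 3 (schurSeries 9) = A at *
  generalize progSection 2 0 (thetaQuot (X : ℤ⟦X⟧)) = W at *
  generalize thetaQuot (-X : ℤ⟦X⟧) = V at *
  set T := theta (-X ^ 9 : ℤ⟦X⟧) (-X ^ 9)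
  refine ⟨T * W * V + 2 * A * X * T * (V ^ 3 + Z) - W * V * Y, ?_⟩
  linear_combination A * htheta + T * hsec + hprod - W * V * hY + 2 * A * X * T * hZ

theorem eight_dvd_progSection_six_one_sub :
    8 ∣ progSection 6 1 (schurSeries 9) - 2 * (theta (-X) (-X ^ 2) * theta X (X ^ 3)) := by
  have hsec := progSection_six_one_schurSeries_nine_mul
  have hW := progSection_two_zero_thetaQuot_mul
  obtain ⟨T, hT⟩ := two_dvd_theta_self_sub_one (a := (-X ^ 3 : ℤ⟦X⟧)) (by simp)
  rw [sub_eq_iff_eq_add] at hT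
  rw [theta_neg_neg_sq_mul_theta_pow_three (by simp), ← hW, hT]
  exact ⟨progSection 6 1 (schurSeries 9) * X * thetaQuot (-X) ^ 3 -
    (T + T ^ 2) * progSection 2 0 (thetaQuot X), by linear_combination hsec⟩

theorem sixteen_dvd_progSection_six_three_sub :
    16 ∣ progSection 6 3 (schurSeries 9) - 4 * (theta (-X) (-X) * theta X (X ^ 3) *
      (theta (-X ^ 3) (-X ^ 3) * theta (X ^ 3) (X ^ 9))) := by
  have hsec := progSection_six_three_schurSeries_nine_mul
  have hprod := progSection_two_zero_thetaQuot_mul_thetaQuot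
  obtain ⟨T, hT⟩ := two_dvd_theta_self_sub_one (a := (-X ^ 3 : ℤ⟦X⟧)) (by simp)
  rw [sub_eq_iff_eq_add] at hT
  rw [show theta (-X) (-X) * theta X (X ^ 3) * (theta (-X ^ 3) (-X ^ 3) *
    theta (X ^ 3) (X ^ 9)) = theta (-X) (-X) * theta X (X ^ 3) * theta (X ^ 3) (X ^ 9) *
      theta (-X ^ 3) (-X ^ 3) by ring, ← hprod, hT]
  generalize progSection 6 3 (schurSeries 9) = A at *
  generalize progSection 2 0 (thetaQuot (X : ℤ⟦X⟧)) = W at *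
  generalize thetaQuot (-X : ℤ⟦X⟧) = V at *
  refine ⟨2 * X * V ^ 3 * (W * V + 2 * X * V ^ 3 * A) -
    W * V * (2 * (T + T ^ 2) + 4 * (T + T ^ 2) ^ 2), ?_⟩
  linear_combination (1 + 8 * X * V ^ 3) * hsec

theorem progSection_three_zero_theta_neg_X_mul_theta :
    progSection 3 0 (theta (-X : ℤ⟦X⟧) (-X) * theta X (X ^ 3)) =
      theta (-X ^ 3) (-X ^ 3) * theta X (X ^ 2) := by
  have hthree := theta_pow_three_eq_add (a := (X : ℤ⟦X⟧)) (by simp)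
  have hself := theta_self_eq_add (a := (-X : ℤ⟦X⟧)) (by simp)
  have hexpand : theta (-X : ℤ⟦X⟧) (-X) * theta X (X ^ 3) =
      X ^ 0 * expand 3 three_ne_zero (theta (-X ^ 3) (-X ^ 3) * theta X (X ^ 2)) +
      X ^ 1 * expand 3 three_ne_zero (theta (-X ^ 3) (-X ^ 3) * theta (X ^ 3) (X ^ 9) -
        2 * (theta (-X) (-X ^ 5) * theta X (X ^ 2))) -
      2 * (X ^ 2 * expand 3 three_ne_zero (theta (-X) (-X ^ 5) * theta (X ^ 3) (X ^ 9))) := by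
    rw [hthree, hself]
    simp only [map_sub, map_mul, map_ofNat, expand_theta, map_neg, map_pow, expand_X, ← pow_mul,
      constantCoeff_X, ne_eq, OfNat.ofNat_ne_zero, not_false_eq_true, zero_pow, neg_zero,
      Nat.reduceMul, Odd.neg_pow (show Odd 3 by decide), Odd.neg_pow (show Odd 9 by decide),
      Odd.neg_pow (show Odd 15 by decide)]
    ring
  rw [hexpand, map_sub, map_add, progSection_ofNat_mul, progSection_X_pow_mul_expand_self,
    progSection_X_pow_mul_expand_eq_zero three_ne_zero dvd_rfl (by decide),
    progSection_X_pow_mul_expand_eq_zero three_ne_zero dvd_rfl (by decide)]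
  ring

theorem sixteen_dvd_progSection_eighteen_three_sub :
    16 ∣ progSection 18 3 (schurSeries 9) - 4 * (theta (-X) (-X ^ 2) * theta X (X ^ 3)) := by
  have hX : constantCoeff (X : ℤ⟦X⟧) = 0 := by simp
  have hsec := ofNat_dvd_progSection 3 0 16 sixteen_dvd_progSection_six_three_sub
  have hexpand : theta (-X ^ 3 : ℤ⟦X⟧) (-X ^ 3) * theta (X ^ 3) (X ^ 9) =
      expand 3 three_ne_zero (theta (-X) (-X) * theta X (X ^ 3)) := by
    rw [map_mul, expand_theta (by simp) (by simp), expand_theta (by simp) (by simp), map_neg,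
      map_pow, expand_X, ← pow_mul]
  rw [map_sub, progSection_comp, progSection_ofNat_mul, hexpand,
    progSection_mul_expand three_ne_zero three_pos,
    progSection_three_zero_theta_neg_X_mul_theta] at hsec
  obtain ⟨T, hT⟩ := two_dvd_theta_self_sub_one (a := (-X ^ 3 : ℤ⟦X⟧)) (by simp)
  rw [sub_eq_iff_eq_add] at hT
  have hprod : theta (-X ^ 3) (-X ^ 3) * theta X (X ^ 2) * (theta (-X) (-X) * theta X (X ^ 3)) =
      theta (-X) (-X ^ 2) * theta X (X ^ 3) * theta (-X ^ 3 : ℤ⟦X⟧) (-X ^ 3) ^ 2 := by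
    linear_combination theta (-X ^ 3) (-X ^ 3) * theta X (X ^ 3) * theta_neg_self_mul_theta_sq hX
  rw [hprod, hT] at hsec
  obtain ⟨Z, hZ⟩ := hsec
  exact ⟨Z + theta (-X) (-X ^ 2) * theta X (X ^ 3) * (T + T ^ 2), by linear_combination hZ⟩

theorem thirtyTwo_dvd_progSection_six_five_sub :
    32 ∣ progSection 6 5 (schurSeries 9) -
      8 * (theta (-X ^ 2) (-X ^ 4) * theta (-X) (-X ^ 5)) ^ 2 := by
  have hsec := progSection_six_five_schurSeries_nine_mul
  have hW := progSection_two_zero_thetaQuot_mul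
  have hV := thetaQuot_neg_X_mul_theta
  obtain ⟨T, hT⟩ := two_dvd_theta_self_sub_one (a := (-X ^ 3 : ℤ⟦X⟧)) (by simp)
  rw [sub_eq_iff_eq_add] at hT
  rw [mul_pow, ← hW, ← hV, hT]
  generalize progSection 6 5 (schurSeries 9) = B at *
  generalize progSection 2 0 (thetaQuot (X : ℤ⟦X⟧)) = W at *
  generalize thetaQuot (-X : ℤ⟦X⟧) = V at *
  refine ⟨2 * X * V ^ 3 * (W * V ^ 2 + X * V ^ 3 * B) -
    W * V ^ 2 * (2 * (T + T ^ 2) + 4 * (T + T ^ 2) ^ 2), ?_⟩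
  linear_combination (1 + 8 * X * V ^ 3) * hsec

theorem sixteen_dvd_progSection_six_five_sub :
    16 ∣ progSection 6 5 (schurSeries 9) -
      8 * expand 2 two_ne_zero (theta (-X ^ 2) (-X ^ 4) * theta (-X) (-X ^ 5)) := by
  obtain ⟨Z, hZ⟩ := thirtyTwo_dvd_progSection_six_five_sub
  obtain ⟨Y, hY⟩ := two_dvd_sq_sub_expand (theta (-X ^ 2) (-X ^ 4) * theta (-X) (-X ^ 5))
  exact ⟨2 * Z + Y, by linear_combination hZ + 8 * hY⟩

theorem progSection_two_one_theta_mul_theta_sq :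
    progSection 2 1 ((theta (-X ^ 2 : ℤ⟦X⟧) (-X ^ 4) * theta (-X) (-X ^ 5)) ^ 2) =
      -(2 * (theta (-X) (-X ^ 2) ^ 2 * (theta (X ^ 4) (X ^ 8) * theta (X ^ 2) (X ^ 10)))) := by
  have hfive := theta_neg_neg_pow_five_eq_sub (a := (X : ℤ⟦X⟧)) (by simp)
  have hexpand : (theta (-X ^ 2 : ℤ⟦X⟧) (-X ^ 4) * theta (-X) (-X ^ 5)) ^ 2 =
      X ^ 0 * expand 2 two_ne_zero ((theta (-X) (-X ^ 2) * theta (X ^ 4) (X ^ 8)) ^ 2) -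
      2 * (X ^ 1 * expand 2 two_ne_zero (theta (-X) (-X ^ 2) ^ 2 *
        (theta (X ^ 4) (X ^ 8) * theta (X ^ 2) (X ^ 10)))) +
      X ^ 2 * expand 2 two_ne_zero ((theta (-X) (-X ^ 2) * theta (X ^ 2) (X ^ 10)) ^ 2) := by
    rw [hfive]
    simp only [map_mul, expand_theta, map_neg, map_pow, expand_X, ← pow_mul,
      constantCoeff_X, ne_eq, OfNat.ofNat_ne_zero, not_false_eq_true, zero_pow, neg_zero,
      Nat.reduceMul]
    ring
  rw [hexpand, map_add, map_sub, progSection_ofNat_mul,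
    progSection_X_pow_mul_expand_eq_zero two_ne_zero dvd_rfl (by decide),
    progSection_X_pow_mul_expand_self,
    progSection_X_pow_mul_expand_eq_zero two_ne_zero dvd_rfl (by decide)]
  ring

theorem two_dvd_progSection_two_zero_sub :
    2 ∣ progSection 2 0 (theta (-X) (-X ^ 2) ^ 2 * (theta (X ^ 4) (X ^ 8) *
      theta (X ^ 2) (X ^ 10))) - theta (X ^ 2) (X ^ 4) * theta (X ^ 3 : ℤ⟦X⟧) (X ^ 9) := by
  obtain ⟨Y, hY⟩ := two_dvd_sq_sub_expand (theta (-X) (-X ^ 2))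
  obtain ⟨T, hT⟩ := two_dvd_theta_self_sub_one (a := (-X : ℤ⟦X⟧)) (by simp)
  obtain ⟨S, hS⟩ := two_dvd_theta_sub_theta_neg_neg (a := (X : ℤ⟦X⟧)) (c := X ^ 4) (by simp)
    (by simp)
  have hfive := theta_neg_neg_sq_mul_theta_neg_neg_pow_five (a := (X : ℤ⟦X⟧)) (by simp)
  have hexpand : theta (X ^ 4 : ℤ⟦X⟧) (X ^ 8) * theta (X ^ 2) (X ^ 10) =
      expand 2 two_ne_zero (theta (X ^ 2) (X ^ 4) * theta X (X ^ 5)) := by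
    rw [map_mul, expand_theta (by simp) (by simp), expand_theta (by simp) (by simp)]
    simp only [map_pow, expand_X, ← pow_mul, Nat.reduceMul]
  rw [← pow_succ'] at hS
  rw [sub_eq_iff_eq_add] at hY
  rw [hexpand, progSection_mul_expand two_ne_zero two_pos, hY, map_add, progSection_ofNat_mul,
    ← one_mul (expand 2 _ _), ← pow_zero X, progSection_X_pow_mul_expand_self]
  refine ⟨progSection 2 0 Y * (theta (X ^ 2) (X ^ 4) * theta X (X ^ 5)) +
    theta (X ^ 2) (X ^ 4) * (theta (-X) (-X ^ 2) * S + T * theta (X ^ 3) (X ^ 9)), ?_⟩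
  linear_combination theta (-X) (-X ^ 2) * theta (X ^ 2) (X ^ 4) * hS +
    theta (X ^ 2) (X ^ 4) * hfive + theta (X ^ 2) (X ^ 4) * theta (X ^ 3) (X ^ 9) * hT

theorem thirtyTwo_dvd_progSection_twentyFour_eleven_sub :
    32 ∣ progSection 24 11 (schurSeries 9) -
      16 * (theta (X ^ 2) (X ^ 4) * theta (X ^ 3) (X ^ 9)) := by
  have hsec := ofNat_dvd_progSection 2 0 32
    (ofNat_dvd_progSection 2 1 32 thirtyTwo_dvd_progSection_six_five_sub)
  rw [map_sub, map_sub, progSection_comp, progSection_comp, progSection_ofNat_mul,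
    progSection_ofNat_mul, progSection_two_one_theta_mul_theta_sq, map_neg,
    progSection_ofNat_mul] at hsec
  obtain ⟨Z, hZ⟩ := hsec
  obtain ⟨Y, hY⟩ := two_dvd_progSection_two_zero_sub
  exact ⟨Z - Y - theta (X ^ 2) (X ^ 4) * theta (X ^ 3) (X ^ 9),
    by linear_combination hZ - 16 * hY⟩

theorem two_dvd_schurSeries_nine_sub_one : 2 ∣ schurSeries 9 - 1 :=
  ⟨X * expand 3 three_ne_zero (thetaQuot X) +
    schurSeries 9 * (X ^ 2 * expand 6 (by decide) (thetaQuot (-X))),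
    by linear_combination schurSeries_nine_mul_one_sub⟩

theorem two_pow_dvd_pow_two_pow_sub_one {R : Type*} [CommRing R] {a : R} (h : 2 ∣ a - 1) (k : ℕ) :
    2 ^ (k + 1) ∣ a ^ 2 ^ k - 1 := by
  induction k with
  | zero => simpa using h
  | succ k ih =>
    have htwo : 2 ∣ a ^ 2 ^ k + 1 := by
      have := ((pow_dvd_pow 2 k.succ_pos).trans ih).add (pow_one (2 : R)).dvd
      rwa [pow_one, show a ^ 2 ^ k - 1 + 2 = a ^ 2 ^ k + 1 by ring] at this
    rw [show a ^ 2 ^ (k + 1) - 1 = (a ^ 2 ^ k - 1) * (a ^ 2 ^ k + 1) by ring, pow_succ]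
    exact mul_dvd_mul ih htwo

theorem two_pow_dvd_pow_sub_self {R : Type*} [CommRing R] {a : R} (h : 2 ∣ a - 1) (k m : ℕ) :
    2 ^ (k + 1) ∣ a ^ (2 ^ k * m + 1) - a := by
  rw [show a ^ (2 ^ k * m + 1) - a = a * ((a ^ 2 ^ k) ^ m - 1 ^ m) by ring]
  exact ((two_pow_dvd_pow_two_pow_sub_one h k).trans (sub_dvd_pow_sub_pow _ _ _)).mul_left a

theorem numSchurOverpartitionTuples_nine_modEq_zero {k m n : ℕ}
    (h : 2 ^ (k + 1) ∣ coeff n (schurSeries 9)) :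
    numSchurOverpartitionTuples 9 (2 ^ k * m + 1) n ≡ 0 [MOD 2 ^ (k + 1)] := by
  have hpow := two_pow_dvd_pow_sub_self two_dvd_schurSeries_nine_sub_one k m
  rw [← map_ofNat C, ← map_pow C, C_dvd_iff_forall_dvd_coeff] at hpow
  have hsub := hpow n
  rw [map_sub, coeff_schurSeries_pow, dvd_sub_left h] at hsub
  rw [Nat.modEq_zero_iff_dvd]
  exact_mod_cast hsub

theorem ofNat_dvd_coeff_of_dvd_progSection_sub {R : Type*} [CommRing R] {a r d n : ℕ}
    [d.AtLeastTwo] {A B : R⟦X⟧} (h : ofNat(d) ∣ progSection a r A - B) (hB : coeff n B = 0) :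
    (ofNat(d) : R) ∣ coeff (a * n + r) A := by
  rw [← map_ofNat C, C_dvd_iff_forall_dvd_coeff] at h
  simpa only [map_sub, coeff_progSection, hB, sub_zero] using h n

end Congruences

section Vanishing

theorem coeff_theta_mul_theta_eq_zero {R : Type*} [CommRing R] [TopologicalSpace R]
    [IsTopologicalRing R] [T2Space R] {b c d e k : ℕ} (hb : b ≠ 0) (hc : c ≠ 0) (hd : d ≠ 0)
    (he : e ≠ 0) (β γ δ ε : R)
    (h : ∀ m n : ℤ, b * triangle m + c * triangle (-m) + (d * triangle n + e * triangle (-n)) ≠ k) :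
    coeff k (theta (C β * X ^ b) (C γ * X ^ c) * theta (C δ * X ^ d) (C ε * X ^ e)) = 0 := by
  have hsum := hasSum_theta_mul_theta (a := C β * X ^ b) (b := C γ * X ^ c)
    (c := C δ * X ^ d) (d := C ε * X ^ e) (by simp [hb]) (by simp [hc]) (by simp [hd])
    (by simp [he])
  refine ((WithPiTopology.hasSum_iff_hasSum_coeff R).1 hsum k).unique
    (hasSum_zero.congr_fun fun i => ?_)
  have hterm : thetaTerm (C β * X ^ b) (C γ * X ^ c) i.1 *
      thetaTerm (C δ * X ^ d) (C ε * X ^ e) i.2 = C (thetaTerm β γ i.1 * thetaTerm δ ε i.2) *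
        X ^ (b * triangle i.1 + c * triangle (-i.1) +
          (d * triangle i.2 + e * triangle (-i.2))) := by
    simp only [thetaTerm, map_mul, map_pow]
    ring
  rw [hterm, coeff_C_mul, coeff_X_pow, if_neg (h i.1 i.2).symm, mul_zero]

variable {p : ℕ} [Fact p.Prime]

theorem even_padicValInt_sq_add_mul_sq {D : ℤ} (hD : legendreSym p (-D) = -1) (x y : ℤ) :
    Even (padicValInt p (x ^ 2 + D * y ^ 2)) := by
  induction h : padicValInt p (x ^ 2 + D * y ^ 2)
    using Nat.strong_induction_on generalizing x y with
  | _ v ih =>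
    rcases eq_or_ne v 0 with rfl | hv
    · exact Even.zero
    obtain ⟨-, hne, hdvd⟩ : p ≠ 1 ∧ x ^ 2 + D * y ^ 2 ≠ 0 ∧ (p : ℤ) ∣ x ^ 2 + D * y ^ 2 := by
      simpa only [← h, ne_eq, padicValInt.eq_zero_iff, not_or, not_not] using hv
    obtain ⟨⟨x, rfl⟩, ⟨y, rfl⟩⟩ :=
      legendreSym.prime_dvd_of_eq_neg_one hD (by rwa [neg_mul, sub_neg_eq_add])
    have hfactor : (p * x) ^ 2 + D * (p * y) ^ 2 = (x ^ 2 + D * y ^ 2) * p * p := by ring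
    rw [hfactor] at h hne
    rw [padicValInt_mul_eq_succ _ (left_ne_zero_of_mul hne),
      padicValInt_mul_eq_succ _ (left_ne_zero_of_mul (left_ne_zero_of_mul hne))] at h
    rw [← h, Nat.even_add_one, Nat.not_even_iff_odd, Nat.odd_add_one, Nat.not_odd_iff_even]
    exact ih _ (by omega) x y rfl

theorem padicValNat_mul_of_not_dvd {m : ℕ} (hm : ¬ p ∣ m) (n : ℕ) :
    padicValNat p (m * n) = padicValNat p n := by
  rcases eq_or_ne n 0 with rfl | hn
  · rw [mul_zero]
  · rw [padicValNat.mul (by rintro rfl; exact hm (dvd_zero p)) hn,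
      padicValNat.eq_zero_of_not_dvd hm, zero_add]

theorem not_dvd_two_pow_mul_three_pow (hp : 5 ≤ p) (a b : ℕ) : ¬ p ∣ 2 ^ a * 3 ^ b := by
  have hprime : p.Prime := Fact.out
  rw [hprime.dvd_mul, not_or]
  exact ⟨fun h => by have := Nat.le_of_dvd two_pos (hprime.dvd_of_dvd_pow h); omega,
    fun h => by have := Nat.le_of_dvd three_pos (hprime.dvd_of_dvd_pow h); omega⟩

/- Completing the squares: with `B = b + c` and `E = d + e`, the exponent of the general term
satisfies `E (8BEk + E(b - c)² + B(d - e)²) = (E(2Bm + b - c))² + BE(2En + d - e)²`. -/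
theorem coeff_theta_mul_theta_eq_zero_of_odd_padicValNat {R : Type*} [CommRing R]
    [TopologicalSpace R] [IsTopologicalRing R] [T2Space R] {b c d e k M N : ℕ} {D q : ℤ}
    (hD : legendreSym p (-D) = -1) (hN : Odd (padicValNat p N)) (hM : ¬ p ∣ M)
    (hb : b ≠ 0) (hc : c ≠ 0) (hd : d ≠ 0) (he : e ≠ 0)
    (hq : (b + c) * (d + e) = D * q ^ 2)
    (hk : (M * N : ℤ) = (d + e) *
      (8 * (b + c) * (d + e) * k + (d + e) * (b - c) ^ 2 + (b + c) * (d - e) ^ 2))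
    (β γ δ ε : R) :
    coeff k (theta (C β * X ^ b) (C γ * X ^ c) * theta (C δ * X ^ d) (C ε * X ^ e)) = 0 := by
  refine coeff_theta_mul_theta_eq_zero hb hc hd he β γ δ ε fun m n h => ?_
  have hform : ((M * N : ℕ) : ℤ) = ((d + e) * (2 * (b + c) * m + (b - c))) ^ 2 +
      D * (q * (2 * (d + e) * n + (d - e))) ^ 2 := by
    zify at h
    push_cast
    linear_combination hk - 8 * (b + c) * (d + e) ^ 2 * h +
      4 * (b + c) * (d + e) ^ 2 * (b * two_mul_triangle m + c * two_mul_triangle (-m) +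
        d * two_mul_triangle n + e * two_mul_triangle (-n)) +
      (2 * (d + e) * n + (d - e)) ^ 2 * hq
  have heven := even_padicValInt_sq_add_mul_sq hD ((d + e) * (2 * (b + c) * m + (b - c)))
    (q * (2 * (d + e) * n + (d - e)))
  rw [← hform, padicValInt.of_nat, padicValNat_mul_of_not_dvd hM] at heven
  exact Nat.not_even_iff_odd.2 hN heven

theorem coeff_theta_neg_X_mul_theta_X_eq_zero (hp : 5 ≤ p) (hD : legendreSym p (-3) = -1) {k : ℕ}
    (hk : Odd (padicValNat p (6 * k + 1))) :
    coeff k (theta (-X) (-X ^ 2) * theta X (X ^ 3) : ℤ⟦X⟧) = 0 := by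
  simpa using coeff_theta_mul_theta_eq_zero_of_odd_padicValNat (b := 1) (c := 2) (d := 1) (e := 3)
    (q := 2) hD hk (not_dvd_two_pow_mul_three_pow hp 6 0) (by decide) (by decide) (by decide)
    (by decide) (by norm_num) (by push_cast; ring) (-1 : ℤ) (-1) 1 1

theorem coeff_theta_X_mul_theta_X_pow_three_eq_zero (hp : 5 ≤ p) (hD : legendreSym p (-3) = -1)
    {k : ℕ} (hk : Odd (padicValNat p (6 * k + 3))) :
    coeff k (theta X (X ^ 3) * theta (X ^ 3) (X ^ 9) : ℤ⟦X⟧) = 0 := by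
  simpa using coeff_theta_mul_theta_eq_zero_of_odd_padicValNat (b := 1) (c := 3) (d := 3) (e := 9)
    (q := 4) hD hk (not_dvd_two_pow_mul_three_pow hp 8 1) (by decide) (by decide) (by decide)
    (by decide) (by norm_num) (by push_cast; ring) (1 : ℤ) 1 1 1

theorem coeff_theta_X_sq_mul_theta_X_pow_three_eq_zero (hp : 5 ≤ p)
    (hD : legendreSym p (-18) = -1) {k : ℕ} (hk : Odd (padicValNat p (24 * k + 11))) :
    coeff k (theta (X ^ 2) (X ^ 4) * theta (X ^ 3) (X ^ 9) : ℤ⟦X⟧) = 0 := by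
  simpa using coeff_theta_mul_theta_eq_zero_of_odd_padicValNat (b := 2) (c := 4) (d := 3) (e := 9)
    (q := 2) hD hk (not_dvd_two_pow_mul_three_pow hp 5 2) (by decide) (by decide) (by decide)
    (by decide) (by norm_num) (by push_cast; ring) (1 : ℤ) 1 1 1

theorem coeff_theta_neg_X_sq_mul_theta_neg_X_eq_zero (hp : 5 ≤ p)
    (hD : legendreSym p (-9) = -1) {k : ℕ} (hk : Odd (padicValNat p (12 * k + 5))) :
    coeff k (theta (-X ^ 2) (-X ^ 4) * theta (-X) (-X ^ 5) : ℤ⟦X⟧) = 0 := by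
  simpa using coeff_theta_mul_theta_eq_zero_of_odd_padicValNat (b := 2) (c := 4) (d := 1) (e := 5)
    (q := 2) hD hk (not_dvd_two_pow_mul_three_pow hp 4 2) (by decide) (by decide) (by decide)
    (by decide) (by norm_num) (by push_cast; ring) (-1 : ℤ) (-1) (-1) (-1)

end Vanishing

section Divisibility

variable {p : ℕ} [Fact p.Prime]

theorem legendreSym_neg_three_of_modEq (h : p ≡ 5 [MOD 6]) : legendreSym p (-3) = -1 := by
  have hmod : p % 6 = 5 := h
  have hthree : legendreSym 3 p = -1 := by
    rw [legendreSym.mod, show (p : ℤ) % (3 : ℕ) = 2 by omega]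
    decide
  rw [show (-3 : ℤ) = -1 * (3 : ℕ) by rfl, legendreSym.mul, legendreSym.at_neg_one (by omega)]
  obtain hfour | hfour : p % 4 = 1 ∨ p % 4 = 3 := by omega
  · rw [ZMod.χ₄_nat_one_mod_four hfour, one_mul,
      ← legendreSym.quadratic_reciprocity_one_mod_four hfour (by decide), hthree]
  · rw [ZMod.χ₄_nat_three_mod_four hfour,
      legendreSym.quadratic_reciprocity_three_mod_four (p := 3) rfl hfour, hthree]
    rfl

theorem exists_eq_mul_add_of_modEq {a r n : ℕ} (hr : r < a) (h : n ≡ r [MOD a]) :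
    ∃ k, n = a * k + r :=
  ⟨n / a, by rw [← Nat.mod_eq_of_lt hr, ← h, Nat.div_add_mod]⟩

theorem numSchurOverpartitions_nine_modEq_zero_of_modEq_three (hp : 5 ≤ p)
    (hD : legendreSym p (-3) = -1) {n : ℕ} (hn : n ≡ 3 [MOD 6]) (hodd : Odd (padicValNat p n)) :
    numSchurOverpartitions 9 n ≡ 0 [MOD 3] := by
  obtain ⟨k, rfl⟩ := exists_eq_mul_add_of_modEq (by decide) hn
  have h := ofNat_dvd_coeff_of_dvd_progSection_sub three_dvd_progSection_six_three_sub
    (coeff_theta_X_mul_theta_X_pow_three_eq_zero hp hD hodd)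
  rw [schurSeries, coeff_mk] at h
  exact Nat.modEq_zero_iff_dvd.2 (by exact_mod_cast h)

theorem numSchurOverpartitionTuples_nine_modEq_zero_of_modEq_one (hp : 5 ≤ p)
    (hD : legendreSym p (-3) = -1) {n : ℕ} (hn : n ≡ 1 [MOD 6]) (hodd : Odd (padicValNat p n))
    (m : ℕ) : numSchurOverpartitionTuples 9 (4 * m + 1) n ≡ 0 [MOD 8] := by
  obtain ⟨k, rfl⟩ := exists_eq_mul_add_of_modEq (by decide) hn
  refine numSchurOverpartitionTuples_nine_modEq_zero (k := 2)
    (ofNat_dvd_coeff_of_dvd_progSection_sub eight_dvd_progSection_six_one_sub ?_)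
  rw [← map_ofNat C, coeff_C_mul, coeff_theta_neg_X_mul_theta_X_eq_zero hp hD hodd, mul_zero]

theorem numSchurOverpartitionTuples_nine_modEq_zero_of_modEq_three (hp : 5 ≤ p)
    (hD : legendreSym p (-3) = -1) {n : ℕ} (hn : n ≡ 3 [MOD 18]) (hodd : Odd (padicValNat p n))
    (m : ℕ) : numSchurOverpartitionTuples 9 (8 * m + 1) n ≡ 0 [MOD 16] := by
  obtain ⟨k, rfl⟩ := exists_eq_mul_add_of_modEq (by decide) hn
  rw [show 18 * k + 3 = 2 ^ 0 * 3 ^ 1 * (6 * k + 1) by ring,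
    padicValNat_mul_of_not_dvd (not_dvd_two_pow_mul_three_pow hp 0 1)] at hodd
  refine numSchurOverpartitionTuples_nine_modEq_zero (k := 3)
    (ofNat_dvd_coeff_of_dvd_progSection_sub sixteen_dvd_progSection_eighteen_three_sub ?_)
  rw [← map_ofNat C, coeff_C_mul, coeff_theta_neg_X_mul_theta_X_eq_zero hp hD hodd, mul_zero]

theorem numSchurOverpartitionTuples_nine_modEq_zero_of_modEq_five (hp : 5 ≤ p)
    (hD : legendreSym p (-9) = -1) {n : ℕ} (hn : n ≡ 5 [MOD 12]) (hodd : Odd (padicValNat p n))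
    (m : ℕ) : numSchurOverpartitionTuples 9 (8 * m + 1) n ≡ 0 [MOD 16] := by
  obtain ⟨k, rfl⟩ := exists_eq_mul_add_of_modEq (by decide) hn
  rw [show 12 * k + 5 = 6 * (2 * k) + 5 by ring]
  refine numSchurOverpartitionTuples_nine_modEq_zero (k := 3)
    (ofNat_dvd_coeff_of_dvd_progSection_sub sixteen_dvd_progSection_six_five_sub ?_)
  rw [← map_ofNat C, coeff_C_mul, coeff_expand_mul,
    coeff_theta_neg_X_sq_mul_theta_neg_X_eq_zero hp hD hodd, mul_zero]

theorem numSchurOverpartitionTuples_nine_modEq_zero_of_modEq_eleven (hp : 5 ≤ p)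
    (hD : legendreSym p (-18) = -1) {n : ℕ} (hn : n ≡ 11 [MOD 24]) (hodd : Odd (padicValNat p n))
    (m : ℕ) : numSchurOverpartitionTuples 9 (16 * m + 1) n ≡ 0 [MOD 32] := by
  obtain ⟨k, rfl⟩ := exists_eq_mul_add_of_modEq (by decide) hn
  refine numSchurOverpartitionTuples_nine_modEq_zero (k := 4)
    (ofNat_dvd_coeff_of_dvd_progSection_sub thirtyTwo_dvd_progSection_twentyFour_eleven_sub ?_)
  rw [← map_ofNat C, coeff_C_mul, coeff_theta_X_sq_mul_theta_X_pow_three_eq_zero hp hD hodd,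
    mul_zero]

theorem prime_sq_modEq_one (hp : 5 ≤ p) : p ^ 2 ≡ 1 [MOD 24] := by
  have hcop : p.Coprime 24 :=
    (Nat.Prime.coprime_iff_not_dvd Fact.out).2 (not_dvd_two_pow_mul_three_pow hp 3 1)
  have hsq : ∀ u : (ZMod 24)ˣ, u ^ 2 = 1 := by decide
  rw [← ZMod.natCast_eq_natCast_iff]
  simpa using congrArg Units.val (hsq (ZMod.unitOfCoprime p hcop))

theorem progression_modEq (hp : 5 ≤ p) {a b : ℕ} (hab : a ∣ b * 24) (α n i : ℕ) :
    a * p ^ (2 * α + 2) * n + (a * i + b * p) * p ^ (2 * α + 1) ≡ b [MOD a] := by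
  have hpow := ((prime_sq_modEq_one hp).pow (α + 1)).mul_left' b
  rw [one_pow, mul_one] at hpow
  rw [show a * p ^ (2 * α + 2) * n + (a * i + b * p) * p ^ (2 * α + 1) =
    a * (p ^ (2 * α + 2) * n + i * p ^ (2 * α + 1)) + b * (p ^ 2) ^ (α + 1) by ring]
  simpa using hpow.of_dvd hab

theorem odd_padicValNat_progression {a i : ℕ} (ha : ¬ p ∣ a) (hi : i ∈ Finset.Icc 1 (p - 1))
    (b α n : ℕ) :
    Odd (padicValNat p (a * p ^ (2 * α + 2) * n + (a * i + b * p) * p ^ (2 * α + 1))) := by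
  have hprime : p.Prime := Fact.out
  obtain ⟨hpos, hlt⟩ := Finset.mem_Icc.1 hi
  have hunit : ¬ p ∣ p * (a * n + b) + a * i := by
    rw [Nat.dvd_add_right (dvd_mul_right _ _), hprime.dvd_mul, not_or]
    exact ⟨ha, Nat.not_dvd_of_pos_of_lt hpos (by omega)⟩
  rw [show a * p ^ (2 * α + 2) * n + (a * i + b * p) * p ^ (2 * α + 1) =
    (p * (a * n + b) + a * i) * p ^ (2 * α + 1) by ring, padicValNat_mul_of_not_dvd hunit,
    padicValNat.prime_pow]
  exact odd_two_mul_add_one α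

end Divisibility

theorem theorem3 (p : ℕ) [Fact p.Prime] (hp : 5 ≤ p) :
    (p ≡ 5 [MOD 6] →
      ∀ α n : ℕ, ∀ i ∈ Finset.Icc 1 (p - 1),
        numSchurOverpartitions 9
          (6 * p ^ (2 * α + 2) * n + (6 * i + 3 * p) * p ^ (2 * α + 1)) ≡ 0 [MOD 3]) ∧
    (legendreSym p (-18) = -1 →
      ∀ m α n : ℕ, ∀ i ∈ Finset.Icc 1 (p - 1),
        numSchurOverpartitionTuples 9 (16 * m + 1)
          (24 * p ^ (2 * α + 2) * n + (24 * i + 11 * p) * p ^ (2 * α + 1)) ≡ 0 [MOD 32]) ∧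
    (legendreSym p (-3) = -1 →
      ∀ m α n : ℕ, ∀ i ∈ Finset.Icc 1 (p - 1),
        numSchurOverpartitionTuples 9 (8 * m + 1)
          (18 * p ^ (2 * α + 2) * n + 3 * (6 * i + p) * p ^ (2 * α + 1)) ≡ 0 [MOD 16]) ∧
    (legendreSym p (-9) = -1 →
      ∀ m α n : ℕ, ∀ i ∈ Finset.Icc 1 (p - 1),
        numSchurOverpartitionTuples 9 (8 * m + 1)
          (12 * p ^ (2 * α + 2) * n + (12 * i + 5 * p) * p ^ (2 * α + 1)) ≡ 0 [MOD 16]) ∧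
    (legendreSym p (-3) = -1 →
      ∀ m α n : ℕ, ∀ i ∈ Finset.Icc 1 (p - 1),
        numSchurOverpartitionTuples 9 (4 * m + 1)
          (6 * p ^ (2 * α + 2) * n + (6 * i + p) * p ^ (2 * α + 1)) ≡ 0 [MOD 8]) := by
  have hdvd := not_dvd_two_pow_mul_three_pow hp
  refine ⟨fun hmod α n i hi => ?_, fun hD m α n i hi => ?_, fun hD m α n i hi => ?_,
    fun hD m α n i hi => ?_, fun hD m α n i hi => ?_⟩
  · exact numSchurOverpartitions_nine_modEq_zero_of_modEq_three hp
      (legendreSym_neg_three_of_modEq hmod) (progression_modEq hp (by decide) α n i)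
      (odd_padicValNat_progression (hdvd 1 1) hi 3 α n)
  · exact numSchurOverpartitionTuples_nine_modEq_zero_of_modEq_eleven hp hD
      (progression_modEq hp (by decide) α n i) (odd_padicValNat_progression (hdvd 3 1) hi 11 α n) m
  · rw [show 3 * (6 * i + p) = 18 * i + 3 * p by ring]
    exact numSchurOverpartitionTuples_nine_modEq_zero_of_modEq_three hp hD
      (progression_modEq hp (by decide) α n i) (odd_padicValNat_progression (hdvd 1 2) hi 3 α n) m
  · exact numSchurOverpartitionTuples_nine_modEq_zero_of_modEq_five hp hD
      (progression_modEq hp (by decide) α n i) (odd_padicValNat_progression (hdvd 2 1) hi 5 α n) m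
  · rw [show 6 * i + p = 6 * i + 1 * p by ring]
    exact numSchurOverpartitionTuples_nine_modEq_zero_of_modEq_one hp hD
      (progression_modEq hp (by decide) α n i) (odd_padicValNat_progression (hdvd 1 1) hi 1 α n) m
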